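/- Let $p\ge 1$, $0<\delta<1$, $n=1/(1-\delta)$, $k>0$, and $m=\delta/(1-\delta)+p-1$. For $\nu>2p$ and a positive definite $p\times p$ matrix $S$, let $IW_p(\nu,S)$ be the inverted Wishart distribution on positive definite matrices $\Sigma$, with density $$\frac{|S|^{(\nu-p-1)/2}\,\mathrm{etr}(-S\Sigma^{-1}/2)}{2^{p(\nu-p-1)/2}\,\Gamma_p((\nu-p-1)/2)\,|\Sigma|^{\nu/2}}$$ with respect to $\prod_{i\le j}d\sigma_{ij}$, where $\mathrm{etr}$ is the exponential of the trace and $\Gamma_p$ is the multivariate gamma function. Let $B_p(m/2,1/2)$ be the singular multivariate beta distribution: it is carried by the positive definite $B$ for which $I_p-B$ is positive semidefinite of rank one, with positive eigenvalue $K$, and has density $$\pi^{-p/2}\,\frac{\Gamma_p((m+1)/2)}{\Gamma_p(m/2)}\,K^{-p/2}\,|B|^{(m-p-1)/2}$$ with respect to the volume element $(dB)=2^{-1}K^{p-1}\,dK\,(dh)$, where $I_p-B=K\,hh'$, $h$ is a unit vector, and $(dh)$ is the surface measure of the unit sphere of $\mathbb{R}^p$. Consider the model $$y_t=\Sigma_t^{1/2}\varepsilon_t\quad(1\le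 t\le N),\qquad \Sigma_{t+1}^{-1}=k\,\mathcal U(\Sigma_t^{-1})'\,B_{t+1}\,\mathcal U(\Sigma_t^{-1})\quad(0\le t\le N-1).$$ Here $\mathcal U(A)$ is the upper triangular Cholesky factor, $A=\mathcal U(A)'\mathcal U(A)$; $\Sigma^{1/2}$ is any measurable choice of a matrix square root, $\Sigma^{1/2}(\Sigma^{1/2})'=\Sigma$ (for instance the Cholesky or the spectral root); and $y^t=(y_1,\dots,y_t)$. For each $0\le t\le N-1$, $\varepsilon_{t+1}\sim N_p(0,I_p)$ is independent of $(y^t,\Sigma_{t+1})$, and $B_{t+1}\sim B_p(m/2,1/2)$ is independent of $(y^t,\Sigma_t)$. Let $0\le t\le N-1$ and suppose that $\Sigma_t\mid y^t\sim IW_p(n+2p,S_t)$, where $S_t$ is a measurable function of $y^t$ that is almost surely positive definite. Then: 1. (One-step prior) $\Sigma_{t+1}\mid y^t\sim IW_p(\delta n+2p,\;k^{-1}S_t)$. 2. (Invariance of the expectation) $\Sigma_t^{-1}$ and $\Sigma_{t+1}^{-1}$ are almost surely integrable under their conditional distributions given $y^t$, and $\mathbb E(\Sigma_{t+1}^{-1}\mid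 y^t)=\mathbb E(\Sigma_t^{-1}\mid y^t)$ almost surely if and only if $$k=\frac{\delta(1-p)+p}{\delta(2-p)+p-1}.$$ 3. (Posterior) $\Sigma_{t+1}\mid y^{t+1}\sim IW_p(n+2p,\;k^{-1}S_t+y_{t+1}y_{t+1}')$. In particular all of this holds, with invariant expectation, for the value of $k$ in part 2. -/

import Mathlib

open MeasureTheory ProbabilityTheory Matrix

noncomputable section

namespace StochVol

/-- Real `p × p` matrices. -/
abbrev Mat (p : ℕ) : Type := Matrix (Fin p) (Fin p) ℝ

/-- `p`-variate real vectors. -/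
abbrev Vec (p : ℕ) : Type := EuclideanSpace ℝ (Fin p)

/-- The Borel (equivalently, product) `σ`-algebra on real `p × p` matrices. -/
instance instMeasurableSpaceMat (p : ℕ) : MeasurableSpace (Mat p) :=
  inferInstanceAs (MeasurableSpace (Fin p → Fin p → ℝ))

instance instBorelSpaceMat (p : ℕ) : BorelSpace (Mat p) :=
  inferInstanceAs (BorelSpace (Fin p → Fin p → ℝ))

instance instStandardBorelSpaceMat (p : ℕ) : StandardBorelSpace (Mat p) :=
  inferInstanceAs (StandardBorelSpace (Fin p → Fin p → ℝ))

/-! ### Cholesky factor -/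

/-- `U` is upper triangular with positive diagonal and `U' U = A`. -/
def IsCholesky {p : ℕ} (U A : Mat p) : Prop :=
  (∀ i j, j < i → U i j = 0) ∧ (∀ i, 0 < U i i) ∧ Uᵀ * U = A

open Classical in
/-- The upper triangular factor `𝒰(A)` of the Cholesky decomposition `A = 𝒰(A)' 𝒰(A)`. It is the
zero matrix if there is no such factor; for positive definite `A` it exists and is unique, see
`isCholesky_choleskyUpper` and `IsCholesky.eq`. -/
def choleskyUpper {p : ℕ} (A : Mat p) : Mat p :=
  if h : ∃ U : Mat p, IsCholesky U A then h.choose else 0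

theorem exists_isCholesky {p : ℕ} {A : Mat p} (hA : A.PosDef) : ∃ U : Mat p, IsCholesky U A := by
  classical
  set L : Mat p := LDL.lowerInv hA with hL
  have hLu : IsUnit L := isUnit_of_invertible L
  have hdetU : IsUnit L.det := (Matrix.isUnit_iff_isUnit_det L).1 hLu
  have hlow : ∀ i j, i < j → L i j = 0 := fun i j h => LDL.lowerInv_triangular hA h
  have hbt : L.BlockTriangular OrderDual.toDual := fun i j h => hlow i j h
  have hdet : L.det = ∏ i, L i i := Matrix.det_of_lowerTriangular L hbt
  have hne : ∀ i, L i i ≠ 0 := by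
    intro i hi
    apply hdetU.ne_zero
    rw [hdet]
    exact Finset.prod_eq_zero (Finset.mem_univ i) hi
  have : Invertible L := hLu.invertible
  have hbi : (L⁻¹).BlockTriangular OrderDual.toDual :=
    Matrix.blockTriangular_inv_of_blockTriangular hbt
  have hilow : ∀ i j, i < j → L⁻¹ i j = 0 := fun i j h => hbi h
  have hdiag : ∀ i, L i i * L⁻¹ i i = 1 := by
    intro i
    have h := congrFun (congrFun (Matrix.mul_nonsing_inv L hdetU) i) i
    rw [Matrix.mul_apply, Finset.sum_eq_single i] at h
    · simpa using h
    · intro j _ hj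
      rcases lt_or_gt_of_ne hj with h1 | h1
      · rw [hilow j i h1, mul_zero]
      · rw [hlow i j h1, zero_mul]
    · simp
  set d : Fin p → ℝ := LDL.diagEntries hA with hd
  have hD : Matrix.diagonal d = L * A * Lᴴ := LDL.diag_eq_lowerInv_conj hA
  have hDpos : (Matrix.diagonal d).PosDef := by
    rw [hD]
    exact (Matrix.IsUnit.posDef_star_right_conjugate_iff hLu).2 hA
  have hdpos : ∀ i, 0 < d i := Matrix.posDef_diagonal_iff.1 hDpos
  let c : Fin p → ℝ := fun i => SignType.sign (L i i) * Real.sqrt (d i)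
  have hcc : ∀ i, c i * c i = d i := by
    intro i
    have h1 : (SignType.sign (L i i) : ℝ) * (SignType.sign (L i i) : ℝ) = 1 := by
      rcases lt_or_gt_of_ne (hne i) with h | h
      · simp [sign_neg h]
      · simp [sign_pos h]
    calc c i * c i = ((SignType.sign (L i i) : ℝ) * (SignType.sign (L i i) : ℝ)) *
          (Real.sqrt (d i) * Real.sqrt (d i)) := by simp only [c]; ring
      _ = d i := by rw [h1, Real.mul_self_sqrt (hdpos i).le, one_mul]
  refine ⟨Matrix.diagonal c * (L⁻¹)ᵀ, ?_, ?_, ?_⟩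
  · intro i j h
    rw [Matrix.diagonal_mul, Matrix.transpose_apply, hilow j i h, mul_zero]
  · intro i
    rw [Matrix.diagonal_mul, Matrix.transpose_apply]
    have hinv : L⁻¹ i i = (L i i)⁻¹ := eq_inv_of_mul_eq_one_right (hdiag i)
    rw [hinv]
    have hs := Real.sqrt_pos.2 (hdpos i)
    rcases lt_or_gt_of_ne (hne i) with h | h
    · simp only [c, sign_neg h]
      have := inv_neg''.2 h
      simp only [SignType.coe_neg_one]
      nlinarith [mul_pos hs (neg_pos.2 this)]
    · simp only [c, sign_pos h]
      have := inv_pos.2 h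
      simp only [SignType.coe_one, one_mul]
      positivity
  · have hdd : Matrix.diagonal c * Matrix.diagonal c = Matrix.diagonal d := by
      rw [Matrix.diagonal_mul_diagonal]
      congr 1
      funext i
      exact hcc i
    rw [Matrix.transpose_mul, Matrix.transpose_transpose, Matrix.diagonal_transpose,
      Matrix.mul_assoc, ← Matrix.mul_assoc (Matrix.diagonal c), hdd, hD,
      Matrix.conjTranspose_eq_transpose_of_trivial, Matrix.transpose_nonsing_inv]
    have hdetT : IsUnit (Lᵀ).det := by rwa [Matrix.det_transpose]
    rw [Matrix.mul_assoc, Matrix.mul_assoc, Matrix.mul_nonsing_inv _ hdetT, Matrix.mul_one,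
      ← Matrix.mul_assoc, Matrix.nonsing_inv_mul _ hdetU, Matrix.one_mul]

theorem isCholesky_choleskyUpper {p : ℕ} {A : Mat p} (hA : A.PosDef) :
    IsCholesky (choleskyUpper A) A := by
  have h := exists_isCholesky hA
  unfold choleskyUpper
  rw [dif_pos h]
  exact h.choose_spec

theorem IsCholesky.eq {p : ℕ} {U V A : Mat p} (hU : IsCholesky U A) (hV : IsCholesky V A) :
    U = V := by
  obtain ⟨hU0, hUp, hUA⟩ := hU
  obtain ⟨hV0, hVp, hVA⟩ := hV
  have key : ∀ i j, i ≤ j → (∀ k < i, ∀ l, U k l = V k l) → U i i * U i j = V i i * V i j := by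
    intro i j _ ih
    have h := congrFun (congrFun (hUA.trans hVA.symm) i) j
    simp only [Matrix.mul_apply, Matrix.transpose_apply] at h
    rw [← Finset.add_sum_erase _ _ (Finset.mem_univ i),
      ← Finset.add_sum_erase (a := i) Finset.univ (fun k => V k i * V k j) (Finset.mem_univ i)] at h
    have hs : ∑ k ∈ Finset.univ.erase i, U k i * U k j
        = ∑ k ∈ Finset.univ.erase i, V k i * V k j := by
      refine Finset.sum_congr rfl fun k hk => ?_
      rcases lt_or_gt_of_ne (Finset.ne_of_mem_erase hk) with h1 | h1
      · rw [ih k h1 i, ih k h1 j]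
      · rw [hU0 k i h1, hV0 k i h1]; simp
    rw [hs] at h
    exact add_right_cancel h
  have hrow : ∀ n : ℕ, ∀ i : Fin p, i.val = n → ∀ j, U i j = V i j := by
    intro n
    induction n using Nat.strong_induction_on with
    | _ n ihn =>
      intro i hi j
      have ih : ∀ k < i, ∀ l, U k l = V k l := fun k hk l =>
        ihn k.val (by rw [← hi]; exact hk) k rfl l
      have hii : U i i = V i i := by
        have h := key i i le_rfl ih
        nlinarith [hUp i, hVp i, mul_self_inj (hUp i).le (hVp i).le |>.1 h]
      rcases lt_or_ge j i with h1 | h1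
      · rw [hU0 i j h1, hV0 i j h1]
      · have h := key i j h1 ih
        rw [hii] at h
        exact mul_left_cancel₀ (hVp i).ne' h
  ext i j
  exact hrow i.val i rfl j

/-- `R` is a (measurable) choice of matrix square root: `R(A) R(A)' = A` for every positive definite
`A`. The lower triangular Cholesky root and the symmetric (spectral) root are examples. -/
def IsMatrixSqrt {p : ℕ} (R : Mat p → Mat p) : Prop :=
  Measurable R ∧ ∀ A : Mat p, A.PosDef → R A * (R A)ᵀ = A

/-! ### Inverted Wishart distribution -/

/-- The symmetric matrix with prescribed entries on and above the diagonal. -/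
def symMat {p : ℕ} (x : {q : Fin p × Fin p // q.1 ≤ q.2} → ℝ) : Mat p :=
  Matrix.of fun i j => x ⟨(min i j, max i j), min_le_max⟩

/-- Lebesgue measure `∏_{i ≤ j} dx_{ij}` on the symmetric `p × p` matrices. -/
def symVolume (p : ℕ) : Measure (Mat p) :=
  (volume : Measure ({q : Fin p × Fin p // q.1 ≤ q.2} → ℝ)).map symMat

/-- The multivariate gamma function
`Γ_p(a) = ∫_{X > 0} etr(-X) |X|^{a - (p+1)/2} dX`, for `a > (p-1)/2`. -/
def multiGamma (p : ℕ) (a : ℝ) : ℝ :=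
  ∫ X in {X : Mat p | X.PosDef}, Real.exp (-X.trace) * X.det ^ (a - (p + 1) / 2) ∂(symVolume p)

/-- The density of the inverted Wishart distribution `IW_p(ν, S)` at a positive definite matrix. -/
def invWishartDensity {p : ℕ} (ν : ℝ) (S X : Mat p) : ℝ :=
  S.det ^ ((ν - p - 1) / 2) * Real.exp (-(S * X⁻¹).trace / 2) /
    (2 ^ ((p : ℝ) * (ν - p - 1) / 2) * multiGamma p ((ν - p - 1) / 2) * X.det ^ (ν / 2))

/-- The inverted Wishart distribution `IW_p(ν, S)`, for `ν > 2p` and positive definite `S`. -/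
def invWishart {p : ℕ} (ν : ℝ) (S : Mat p) : Measure (Mat p) :=
  (symVolume p).withDensity
    ({X : Mat p | X.PosDef}.indicator fun X => ENNReal.ofReal (invWishartDensity ν S X))

/-! ### Singular multivariate beta distribution -/

/-- The volume element on the positive semidefinite matrices `X` of rank one: writing
`X = l h h'` with `l > 0` and a unit vector `h`, it is `(dX) = 2⁻¹ l^{p-1} dl (dh)`, where `(dh)` is
the unnormalised surface measure of the sphere (`h` and `-h` give the same `X`). -/
def rankOneVolume (p : ℕ) : Measure (Mat p) :=
  (((volume : Measure ℝ).restrict (Set.Ioi 0)).prod (volume : Measure (Vec p)).toSphere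
    |>.withDensity fun q => ENNReal.ofReal (q.1 ^ (p - 1) / 2)).map
      fun q => q.1 • Matrix.vecMulVec (fun i => (q.2 : Vec p) i) (fun i => (q.2 : Vec p) i)

/-- The singular multivariate beta distribution `B_p(m/2, 1/2)`, for `m > p - 1`: it lives on the
positive definite `B` such that `I - B = H K H'` is positive semidefinite of rank one, `K` being its
positive eigenvalue, i.e. its trace, and there it has density
`π^{-p/2} Γ_p((m+1)/2) / Γ_p(m/2) |K|^{-p/2} |B|^{(m-p-1)/2}`. -/
def singularBeta (p : ℕ) (m : ℝ) : Measure (Mat p) :=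
  ((rankOneVolume p).map fun X => 1 - X).withDensity
    ({B : Mat p | B.PosDef}.indicator fun B => ENNReal.ofReal
      (Real.pi ^ (-(p : ℝ) / 2) * (multiGamma p ((m + 1) / 2) / multiGamma p (m / 2)) *
        (1 - B).trace ^ (-(p : ℝ) / 2) * B.det ^ ((m - p - 1) / 2)))

/-! ### The stochastic volatility model -/

/-- The information `y^t = (y_1, …, y_t)`. -/
def obs {Ω : Type*} {p : ℕ} (y : ℕ → Ω → Vec p) (t : ℕ) (ω : Ω) : Fin t → Vec p :=
  fun i => y (i + 1) ω

/-- The stochastic volatility model with discount factor `δ` and constant `k`, on the time points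
`1, …, N`, for the root `R`: observations `y_t = Σ_t^{1/2} ε_t`, `ε_t ∼ N_p(0, I)`, and evolution
`Σ_{t+1}⁻¹ = k 𝒰(Σ_t⁻¹)' B_{t+1} 𝒰(Σ_t⁻¹)`, `B_{t+1} ∼ B_p(m/2, 1/2)`, `m = δ(1-δ)⁻¹ + p - 1`. The
shock `B_{t+1}` is independent of `Σ_t` and the past observations `y^t`, and the innovation
`ε_{t+1}` is independent of `Σ_{t+1}` and `y^t`. -/
structure VolatilityModel {Ω : Type*} [MeasurableSpace Ω] (P : Measure Ω) {p : ℕ} (N : ℕ)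
    (δ k : ℝ) (R : Mat p → Mat p) (y : ℕ → Ω → Vec p) (Sig B : ℕ → Ω → Mat p)
    (ε : ℕ → Ω → Vec p) : Prop where
  measurable_y : ∀ t, Measurable (y t)
  measurable_Sig : ∀ t, Measurable (Sig t)
  measurable_B : ∀ t, Measurable (B t)
  measurable_ε : ∀ t, Measurable (ε t)
  observation : ∀ t < N, ∀ᵐ ω ∂P,
    y (t + 1) ω = WithLp.toLp 2 (R (Sig (t + 1) ω) *ᵥ (ε (t + 1) ω).ofLp)
  law_ε : ∀ t < N, HasLaw (ε (t + 1)) (stdGaussian (Vec p)) P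
  indep_ε : ∀ t < N, IndepFun (ε (t + 1)) (fun ω => (obs y t ω, Sig (t + 1) ω)) P
  evolution : ∀ t < N, ∀ᵐ ω ∂P,
    (Sig (t + 1) ω)⁻¹ =
      k • ((choleskyUpper (Sig t ω)⁻¹)ᵀ * B (t + 1) ω * choleskyUpper (Sig t ω)⁻¹)
  law_B : ∀ t < N, HasLaw (B (t + 1)) (singularBeta p (δ * (1 - δ)⁻¹ + p - 1)) P
  indep_B : ∀ t < N, IndepFun (B (t + 1)) (fun ω => (obs y t ω, Sig t ω)) P

/-- `X | Y ∼ IW_p(ν, S(Y))`: for almost every value `z` of `Y`, the matrix `S(z)` is positive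
definite and the regular conditional distribution of `X` given `Y = z` is `IW_p(ν, S(z))`. -/
def CondInvWishart {Ω E : Type*} [MeasurableSpace Ω] [MeasurableSpace E] {p : ℕ} (P : Measure Ω)
    [IsFiniteMeasure P] (X : Ω → Mat p) (Y : Ω → E) (ν : ℝ) (S : E → Mat p) : Prop :=
  ∀ᵐ z ∂(P.map Y), (S z).PosDef ∧ condDistrib X Y P z = invWishart ν (S z)

/-- All entries of `X⁻¹` are integrable for the law `μ` of the random matrix `X`. -/
def InvIntegrable {p : ℕ} (μ : Measure (Mat p)) : Prop :=
  ∀ i j, Integrable (fun X : Mat p => X⁻¹ i j) μ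

/-- The expectation of `X⁻¹`, entry by entry, when `X` has law `μ`. -/
def meanInv {p : ℕ} (μ : Measure (Mat p)) : Mat p :=
  Matrix.of fun i j => ∫ X, X⁻¹ i j ∂μ

end StochVol

end

/-!
Write `W = Σ_t⁻¹`; given `y^t` it has the Wishart density proportional to
`|W| ^ ((m - p) / 2) etr (-S W / 2)`, where `m + 1 = n + p - 1` and `m = δ n + p - 1`.

*Prior.* In terms of `B = I - v v'` the volume element `2⁻¹ K ^ (p - 1) dK (dh)` is `|v| ^ p dv`
(`lintegral_rankOneVolume`), so that the singular beta law is that of `I - v v'` for `v` in the unit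
ball with density proportional to `|I - v v'| ^ ((m - p - 1) / 2)` (`lintegral_singularBeta`). With
`W = U' U` and `x = U' v`, the matrix `U' B U` is `A = W - x x'`. For fixed `W` the substitution
`v ↦ x` is linear, and it removes all powers of `|W|` from the joint density; for fixed `x` the
substitution `W ↦ A` is a translation. The joint density of `(A, x)` is then
`|A| ^ ((m - p - 1) / 2) etr (-S A / 2) exp (-x' S x / 2)`, up to a constant: integrating out the
Gaussian variable `x` leaves the Wishart density for `A` with one degree of freedom less. This is
`lintegral_invWishart_singularBeta`. The passage between `Σ` and `W` needs the Jacobian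
`|X| ^ (-(p + 1))` of inversion on symmetric matrices (`lintegral_symVolume_inv`), which comes from the
determinant `|A| ^ (p + 1)` of the congruence `X ↦ A X A'` (`det_congLin`).

*Normalisation.* No value of `Γ_p` is computed. By assumption `IW_p(n + 2p, S)` is a probability
measure for one positive definite `S`, hence for all of them, as these are congruent
(`isProbabilityMeasure_invWishart`); the evolution then transports this to `IW_p(δ n + 2p, S)`.

*Mean.* Tilting the density by `exp (u h' Σ⁻¹ h)` replaces `S` by `S - 2 u h h'`. This gives the moment
generating function of `h' Σ⁻¹ h` (`lintegral_exp_quadForm`), whence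
`𝔼 Σ⁻¹ = (ν - p - 1) S⁻¹` under `IW_p(ν, S)`. The two conditional means are `(m + 1) S_t⁻¹` and
`m k S_t⁻¹`, and they agree exactly for `k = (m + 1) / m`.

*Posterior.* The product of the `IW_p(ν, T)` density at `Σ` and the `N_p(0, Σ)` density at `y` is a
function of `(T, y)` times the `IW_p(ν + 1, T + y y')` density at `Σ`
(`lintegral_invWishart_gaussian`); the latter being normalised, it is the conditional density of `Σ`
given `y`.
-/

namespace StochVol

open scoped ENNReal

variable {p : ℕ}

/-! ### Coordinates on symmetric matrices -/

/-- Index set of the entries on and above the diagonal, the coordinates on symmetric matrices. -/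
abbrev UpperIdx (p : ℕ) : Type := {q : Fin p × Fin p // q.1 ≤ q.2}

/-- The entries of a matrix on and above the diagonal; left inverse of `symMat`. -/
def vech (X : Mat p) : UpperIdx p → ℝ := fun q => X q.1.1 q.1.2

theorem vech_symMat (x : UpperIdx p → ℝ) : vech (symMat x) = x := by
  funext ⟨⟨i, j⟩, hq⟩
  have hij : i ≤ j := hq
  simp [vech, symMat, hij]

theorem symMat_vech {X : Mat p} (hX : X.IsSymm) : symMat (vech X) = X := by
  ext i j
  rcases le_total i j with h | h
  · simp [vech, symMat, h]
  · simp [vech, symMat, h, hX.apply]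

theorem isSymm_symMat (x : UpperIdx p → ℝ) : (symMat x).IsSymm := by
  ext i j
  simp [symMat, min_comm, max_comm]

theorem measurable_entry (i j : Fin p) : Measurable fun X : Mat p => X i j :=
  (measurable_pi_apply j).comp (measurable_pi_apply (X := fun _ : Fin p => Fin p → ℝ) i)

theorem measurable_of_entries {α : Type*} [MeasurableSpace α] {f : α → Mat p}
    (h : ∀ i j, Measurable fun a => f a i j) : Measurable f :=
  measurable_pi_lambda f fun i => measurable_pi_lambda (fun a => f a i) (h i)

theorem measurable_symMat : Measurable (symMat (p := p)) :=
  measurable_of_entries fun _ _ => measurable_pi_apply _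

theorem measurableEmbedding_symMat : MeasurableEmbedding (symMat (p := p)) :=
  measurable_symMat.measurableEmbedding
    (Function.LeftInverse.injective (g := vech) vech_symMat)

instance instSFiniteSymVolume : SFinite (symVolume p) := inferInstanceAs (SFinite (Measure.map _ _))

theorem lintegral_symVolume (f : Mat p → ℝ≥0∞) :
    ∫⁻ X, f X ∂symVolume p = ∫⁻ x, f (symMat x) :=
  measurableEmbedding_symMat.lintegral_map f

theorem symMat_add (x y : UpperIdx p → ℝ) : symMat (x + y) = symMat x + symMat y := rfl

theorem symMat_smul (c : ℝ) (x : UpperIdx p → ℝ) : symMat (c • x) = c • symMat x := rfl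

/-- Lebesgue measure on symmetric matrices is invariant under translation by a symmetric matrix. -/
theorem lintegral_symVolume_add (f : Mat p → ℝ≥0∞) {Y : Mat p} (hY : Y.IsSymm) :
    ∫⁻ X, f (X + Y) ∂symVolume p = ∫⁻ X, f X ∂symVolume p := by
  rw [lintegral_symVolume, lintegral_symVolume]
  have h : ∀ x : UpperIdx p → ℝ, symMat x + Y = symMat (x + vech Y) := fun x => by
    rw [symMat_add, symMat_vech hY]
  simp_rw [h]
  exact lintegral_add_right_eq_self (μ := volume) (fun x => f (symMat x)) (vech Y)

/-! ### Jacobian of a congruence -/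

/-- The congruence `X ↦ A X A'`, in the coordinates of symmetric matrices. -/
def congLin (A : Mat p) : (UpperIdx p → ℝ) →ₗ[ℝ] (UpperIdx p → ℝ) where
  toFun x := vech (A * symMat x * Aᵀ)
  map_add' x y := by
    rw [symMat_add, Matrix.mul_add, Matrix.add_mul]; rfl
  map_smul' c x := by
    rw [symMat_smul, Matrix.mul_smul, Matrix.smul_mul]; rfl

theorem congLin_apply (A : Mat p) (x : UpperIdx p → ℝ) :
    congLin A x = vech (A * symMat x * Aᵀ) := rfl

theorem symMat_congLin (A : Mat p) (x : UpperIdx p → ℝ) :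
    symMat (congLin A x) = A * symMat x * Aᵀ := by
  rw [congLin_apply]
  refine symMat_vech ?_
  have := isSymm_symMat x
  unfold Matrix.IsSymm at *
  simp [Matrix.transpose_mul, this, Matrix.mul_assoc]

/-- Determinant of the congruence action, as a monoid homomorphism. -/
noncomputable def congDet (p : ℕ) : Mat p →* ℝ where
  toFun A := LinearMap.det (congLin A)
  map_one' := by
    have : congLin (1 : Mat p) = LinearMap.id := by
      ext1 x
      ext1
      simp [congLin_apply, vech_symMat]
    rw [this, LinearMap.det_id]
  map_mul' A B := by
    have : congLin (A * B) = congLin A ∘ₗ congLin B := by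
      refine LinearMap.ext fun x => ?_
      rw [LinearMap.comp_apply, congLin_apply, congLin_apply A, symMat_congLin]
      simp [Matrix.transpose_mul, Matrix.mul_assoc]
    rw [this, LinearMap.det_comp]

/-- A multiplicative function of square matrices that is the `r`-th power of the determinant on
diagonal matrices is so everywhere: a transvection is conjugate to its own square by a diagonal
matrix, so that the function is `1` there. -/
theorem monoidHom_eq_det_pow (f : Mat p →* ℝ) (r : ℕ)
    (hf : ∀ d : Fin p → ℝ, f (diagonal d) = (∏ i, d i) ^ r) (A : Mat p) : f A = A.det ^ r := by
  have htrans : ∀ (i j : Fin p) (c : ℝ), i ≠ j → f (transvection i j c) = 1 := by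
    intro i j c hij
    set D : Mat p := diagonal (Function.update 1 i 2) with hD
    have hDne : f D ≠ 0 := by
      rw [hD, hf]
      refine pow_ne_zero _ (Finset.prod_ne_zero_iff.2 fun l _ => ?_)
      by_cases h : l = i <;> simp [h]
    -- conjugation by `D` doubles the off-diagonal entry
    have hconj : D * transvection i j c = transvection i j (c + c) * D := by
      ext a b
      simp only [hD, transvection, Matrix.add_apply, Matrix.diagonal_mul, Matrix.mul_diagonal,
        Matrix.single_apply, Function.update_apply, Pi.one_apply, Matrix.one_apply]
      by_cases h1 : i = a
      · subst h1
        by_cases h2 : j = b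
        · subst h2
          simp [hij, hij.symm, two_mul]
        · by_cases h3 : i = b
          · simp [hij.symm, ← h3]
          · simp [h2, h3]
      · by_cases h3 : a = b
        · simp [h1, ← h3]
        · simp [h1, h3]
    have h1 : f (transvection i j (c + c)) = f (transvection i j c) * f (transvection i j c) := by
      rw [← map_mul, Matrix.transvection_mul_transvection_same _ _ hij]
    have h2 : f (transvection i j c) * f (transvection i j (-c)) = 1 := by
      rw [← map_mul, Matrix.transvection_mul_transvection_same _ _ hij, add_neg_cancel,
        Matrix.transvection_zero, map_one]
    have h3 : f (transvection i j c) ≠ 0 := left_ne_zero_of_mul_eq_one h2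
    have h4 := congrArg f hconj
    rw [map_mul, map_mul, h1, mul_comm (f D)] at h4
    have h5 := mul_right_cancel₀ hDne h4
    exact (mul_left_cancel₀ h3 (by rw [mul_one]; exact h5)).symm
  refine diagonal_transvection_induction (fun M => f M = M.det ^ r) A ?_ ?_ ?_
  · intro D _
    rw [hf, det_diagonal]
  · intro t
    rw [TransvectionStruct.toMatrix, htrans _ _ _ t.hij, det_transvection_of_ne _ _ t.hij, one_pow]
  · intro A B hA hB
    rw [map_mul, hA, hB, det_mul, mul_pow]

/-- An index `i` occurs in the pairs `i ≤ j` once for each `j ≥ i` and once for each `j ≤ i`,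
`p + 1` times in all. -/
theorem prod_upperIdx_mul (d : Fin p → ℝ) :
    ∏ q : UpperIdx p, d q.1.1 * d q.1.2 = (∏ i, d i) ^ (p + 1) := by
  have h1 : ∀ g : Fin p × Fin p → ℝ, ∏ q : UpperIdx p, g q.1
      = ∏ i, ∏ j, if i ≤ j then g (i, j) else 1 := by
    intro g
    rw [← Fintype.prod_prod_type' (fun i j => if i ≤ j then g (i, j) else 1),
      ← Finset.prod_filter (fun q : Fin p × Fin p => q.1 ≤ q.2) g]
    exact (Finset.prod_subtype _ (by simp) g).symm
  rw [Finset.prod_mul_distrib, h1 fun q => d q.1, h1 fun q => d q.2]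
  rw [Finset.prod_comm (f := fun i j => if i ≤ j then d j else 1), ← Finset.prod_mul_distrib,
    ← Finset.prod_pow]
  refine Finset.prod_congr rfl fun i _ => ?_
  rw [← Finset.prod_filter, ← Finset.prod_filter]
  simp only [Finset.prod_const]
  rw [← pow_add]
  congr 1
  have e1 : (Finset.univ.filter fun j => i ≤ j) = Finset.Ici i := by ext; simp
  have e2 : (Finset.univ.filter fun j => j ≤ i) = Finset.Iic i := by ext; simp
  rw [e1, e2, Fin.card_Ici, Fin.card_Iic]
  omega

/-- The Jacobian of the congruence `X ↦ A X A'` on symmetric matrices is `|A| ^ (p + 1)`. -/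
theorem det_congLin (A : Mat p) : LinearMap.det (congLin A) = A.det ^ (p + 1) := by
  refine monoidHom_eq_det_pow (congDet p) (p + 1) (fun d => ?_) A
  rw [← prod_upperIdx_mul]
  change LinearMap.det (congLin (diagonal d)) = _
  have h : LinearMap.toMatrix' (congLin (diagonal d))
      = diagonal fun q : UpperIdx p => d q.1.1 * d q.1.2 := by
    ext q r
    have hq : q.1.1 ≤ q.1.2 := q.2
    simp only [LinearMap.toMatrix'_apply, congLin_apply, vech, Matrix.diagonal_transpose,
      Matrix.mul_diagonal, Matrix.diagonal_mul, symMat, Matrix.of_apply, Matrix.diagonal_apply,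
      min_eq_left hq, max_eq_right hq, Pi.single_apply]
    by_cases h : q = r
    · simp [h]
    · simp [h]
  rw [← LinearMap.det_toMatrix', h, det_diagonal]

/-- Change of variables `X ↦ A X A'` on the symmetric matrices. -/
theorem lintegral_symVolume_cong (f : Mat p → ℝ≥0∞) {A : Mat p} (hA : A.det ≠ 0) :
    ENNReal.ofReal (|A.det| ^ (p + 1)) * ∫⁻ X, f (A * X * Aᵀ) ∂symVolume p
      = ∫⁻ X, f X ∂symVolume p := by
  rw [lintegral_symVolume, lintegral_symVolume]
  simp_rw [← symMat_congLin]
  have hdet : LinearMap.det (congLin A) ≠ 0 := by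
    rw [det_congLin]; exact pow_ne_zero _ hA
  have hmap := Measure.map_linearMap_addHaar_eq_smul_addHaar
    (volume : Measure (UpperIdx p → ℝ)) hdet
  have hemb : MeasurableEmbedding (congLin A) :=
    (LinearMap.continuous_of_finiteDimensional (congLin A)).measurable.measurableEmbedding
      (LinearMap.equivOfDetNeZero (congLin A) hdet).injective
  rw [← hemb.lintegral_map (fun x => f (symMat x)) (μ := volume), hmap, lintegral_smul_measure,
    smul_eq_mul, ← mul_assoc, ← ENNReal.ofReal_mul (by positivity), det_congLin, abs_inv, abs_pow,
    mul_inv_cancel₀ (by positivity), ENNReal.ofReal_one, one_mul]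

/-! ### Positive definite matrices and inversion -/

theorem measurableSet_posDef : MeasurableSet {X : Mat p | X.PosDef} := by
  have h1 : {X : Mat p | X.PosDef} = {X : Mat p | X.PosSemidef} ∩ {X : Mat p | X.det ≠ 0} := by
    ext X
    simp only [Set.mem_ofPred_eq, Set.mem_inter_iff]
    refine ⟨fun h => ⟨h.posSemidef, h.det_pos.ne'⟩, fun h => ?_⟩
    exact h.1.posDef_iff_isUnit.2 ((Matrix.isUnit_iff_isUnit_det _).2 (isUnit_iff_ne_zero.2 h.2))
  have h2 : {X : Mat p | X.PosSemidef} = {X : Mat p | Xᵀ = X} ∩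
      ⋂ x : Fin p → ℝ, {X : Mat p | 0 ≤ x ⬝ᵥ X *ᵥ x} := by
    ext X
    simp only [Set.mem_ofPred_eq, Set.mem_inter_iff, Set.mem_iInter]
    rw [Matrix.posSemidef_iff_dotProduct_mulVec]
    simp [Matrix.IsHermitian]
  rw [h1, h2]
  refine MeasurableSet.inter (MeasurableSet.inter ?_ ?_) ?_
  · exact (isClosed_eq (by fun_prop) (by fun_prop)).measurableSet
  · exact (isClosed_iInter fun x => isClosed_le (by fun_prop) (by fun_prop)).measurableSet
  · exact (isOpen_ne_fun (by fun_prop) (by fun_prop)).measurableSet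

theorem measurable_det : Measurable fun X : Mat p => X.det :=
  Continuous.measurable (by fun_prop)

theorem measurable_inv : Measurable fun X : Mat p => X⁻¹ := by
  refine measurable_of_entries fun i j => ?_
  simp only [Matrix.inv_def, Ring.inverse_eq_inv', Matrix.smul_apply, smul_eq_mul]
  refine measurable_det.inv.mul ?_
  exact Continuous.measurable (by fun_prop)

section Derivative

-- any submultiplicative norm inducing the product topology would do
attribute [local instance] Matrix.linftyOpNormedRing Matrix.linftyOpNormedAlgebra

/-- The derivative of inversion at `X` is `H ↦ -X⁻¹ H X⁻¹`, for symmetric `X` the negative of the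
congruence by `X⁻¹`. -/
theorem hasFDerivAt_vech_inv {x : UpperIdx p → ℝ} (hx : (symMat x).det ≠ 0) :
    HasFDerivAt (fun x : UpperIdx p → ℝ => vech (symMat x)⁻¹)
      (-(congLin (symMat x)⁻¹).toContinuousLinearMap) x := by
  have hu : IsUnit (symMat x) := (Matrix.isUnit_iff_isUnit_det _).2 (isUnit_iff_ne_zero.2 hx)
  obtain ⟨u, hu⟩ := hu
  have h1 := hasFDerivAt_ringInverse (𝕜 := ℝ) u
  rw [hu] at h1
  let s : (UpperIdx p → ℝ) →ₗ[ℝ] Mat p :=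
    { toFun := symMat, map_add' := symMat_add, map_smul' := symMat_smul }
  let v : Mat p →ₗ[ℝ] (UpperIdx p → ℝ) :=
    { toFun := vech, map_add' := fun _ _ => rfl, map_smul' := fun _ _ => rfl }
  have h2 : HasFDerivAt (fun x : UpperIdx p → ℝ => symMat x) s.toContinuousLinearMap x :=
    s.toContinuousLinearMap.hasFDerivAt
  have h3 := (v.toContinuousLinearMap.hasFDerivAt (x := Ring.inverse (symMat x))).comp x
    (h1.comp x h2)
  have hinv : (↑u⁻¹ : Mat p) = (symMat x)⁻¹ := by rw [← hu, Matrix.coe_units_inv]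
  refine (h3.congr_fderiv ?_).congr_of_eventuallyEq (Filter.Eventually.of_forall fun y => ?_)
  · refine ContinuousLinearMap.ext fun y => ?_
    have hs : ((symMat x)⁻¹)ᵀ = (symMat x)⁻¹ := by
      rw [Matrix.transpose_nonsing_inv, isSymm_symMat x]
    change vech (-((↑u⁻¹ : Mat p) * symMat y * (↑u⁻¹ : Mat p)))
      = -vech ((symMat x)⁻¹ * symMat y * ((symMat x)⁻¹)ᵀ)
    rw [hinv, hs]
    rfl
  · change vech (symMat y)⁻¹ = vech (Ring.inverse (symMat y))
    rw [Matrix.nonsing_inv_eq_ringInverse]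

end Derivative

/-- Change of variables `X ↦ X⁻¹` on the cone of positive definite matrices, with Jacobian
`|X| ^ (-(p + 1))`. -/
theorem lintegral_symVolume_inv (f : Mat p → ℝ≥0∞) :
    ∫⁻ X in {X : Mat p | X.PosDef}, ENNReal.ofReal ((X.det ^ (p + 1))⁻¹) * f X⁻¹ ∂symVolume p
      = ∫⁻ X in {X : Mat p | X.PosDef}, f X ∂symVolume p := by
  set s : Set (UpperIdx p → ℝ) := symMat ⁻¹' {X : Mat p | X.PosDef} with hs
  have hsm : MeasurableSet s := measurable_symMat measurableSet_posDef
  have hres : ∀ g : Mat p → ℝ≥0∞, ∫⁻ X in {X : Mat p | X.PosDef}, g X ∂symVolume p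
      = ∫⁻ x in s, g (symMat x) := by
    intro g
    rw [symVolume, measurableEmbedding_symMat.restrict_map, measurableEmbedding_symMat.lintegral_map]
  rw [hres, hres]
  have hsymm : ∀ x ∈ s, symMat (vech (symMat x)⁻¹) = (symMat x)⁻¹ := fun x hx =>
    symMat_vech (by simpa [Matrix.IsHermitian, Matrix.IsSymm] using (Matrix.PosDef.inv hx).1)
  have hinvol : ∀ x ∈ s, vech (symMat (vech (symMat x)⁻¹))⁻¹ = x := fun x hx => by
    rw [hsymm x hx, Matrix.nonsing_inv_nonsing_inv _ (isUnit_iff_ne_zero.2 (Matrix.PosDef.det_pos hx).ne'),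
      vech_symMat]
  have hmem : ∀ x ∈ s, vech (symMat x)⁻¹ ∈ s := fun x hx => by
    change (symMat (vech (symMat x)⁻¹)).PosDef
    rw [hsymm x hx]
    exact Matrix.PosDef.inv hx
  have himage : (fun x => vech (symMat x)⁻¹) '' s = s := by
    refine Set.Subset.antisymm (Set.image_subset_iff.2 hmem) fun x hx => ?_
    exact ⟨_, hmem x hx, hinvol x hx⟩
  have hinj : Set.InjOn (fun x => vech (symMat x)⁻¹) s := fun x hx y hy h => by
    rw [← hinvol x hx, ← hinvol y hy]
    simp only at h
    rw [h]
  have key := lintegral_image_eq_lintegral_abs_det_fderiv_mul volume hsm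
    (fun x hx => (hasFDerivAt_vech_inv (Matrix.PosDef.det_pos hx).ne').hasFDerivWithinAt) hinj
    (fun x => f (symMat x))
  rw [himage] at key
  rw [key]
  refine setLIntegral_congr_fun hsm fun x hx => ?_
  have hdet : 0 < (symMat x).det := Matrix.PosDef.det_pos hx
  rw [hsymm x hx]
  congr 2
  have : (-(congLin (symMat x)⁻¹).toContinuousLinearMap).det
      = LinearMap.det (-(congLin (symMat x)⁻¹)) := rfl
  rw [this, ← neg_one_smul ℝ (congLin _), LinearMap.det_smul, det_congLin, abs_mul, abs_pow, abs_neg,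
    abs_one, one_pow, one_mul, Matrix.det_nonsing_inv, Ring.inverse_eq_inv', inv_pow, abs_inv,
    abs_of_pos (by positivity)]

/-! ### The Cholesky factor -/

/-- The Cholesky factor is a measurable function of the matrix: `U ↦ U' U` is injective on the upper
triangular matrices with positive diagonal, hence a measurable embedding by the Lusin–Souslin
theorem, and `choleskyUpper` extends its inverse by zero. -/
theorem measurable_choleskyUpper : Measurable (choleskyUpper (p := p)) := by
  set T : Set (Mat p) := {U | (∀ i j, j < i → U i j = 0) ∧ ∀ i, 0 < U i i} with hT
  have hTm : MeasurableSet T := by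
    have : T = (⋂ i, ⋂ j, ⋂ _ : j < i, {U : Mat p | U i j = 0}) ∩ ⋂ i, {U : Mat p | 0 < U i i} := by
      ext U; simp [hT]
    rw [this]
    refine MeasurableSet.inter ?_ ?_
    · exact .iInter fun i => .iInter fun j => .iInter fun _ =>
        measurableSet_eq_fun (measurable_entry i j) measurable_const
    · exact .iInter fun i => measurableSet_lt measurable_const (measurable_entry i i)
  have : StandardBorelSpace T := hTm.standardBorel
  set g : T → Mat p := fun U => (U : Mat p)ᵀ * (U : Mat p) with hg
  have hgm : Measurable g := by
    have h : Measurable fun U : Mat p => Uᵀ * U := Continuous.measurable (by fun_prop)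
    exact h.comp measurable_subtype_coe
  have hginj : Function.Injective g := fun U V h =>
    Subtype.ext (IsCholesky.eq (A := g V) ⟨U.2.1, U.2.2, h⟩ ⟨V.2.1, V.2.2, rfl⟩)
  have hext : choleskyUpper (p := p) = Function.extend g Subtype.val fun _ => 0 := by
    funext A
    by_cases h : ∃ U : Mat p, IsCholesky U A
    · obtain ⟨U, hU⟩ := h
      have hA : g ⟨U, hU.1, hU.2.1⟩ = A := hU.2.2
      have h1 : IsCholesky (choleskyUpper A) A := by
        have hex : ∃ U : Mat p, IsCholesky U A := ⟨U, hU⟩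
        unfold choleskyUpper
        rw [dif_pos hex]
        exact hex.choose_spec
      rw [h1.eq hU, ← hA, hginj.extend_apply]
    · rw [Function.extend_apply', choleskyUpper, dif_neg h]
      rintro ⟨U, rfl⟩
      exact h ⟨U, U.2.1, U.2.2, rfl⟩
  rw [hext]
  exact (hgm.measurableEmbedding hginj).measurable_extend measurable_subtype_coe measurable_const

theorem IsCholesky.det_mul_self {U A : Mat p} (h : IsCholesky U A) : U.det * U.det = A.det := by
  rw [← h.2.2, det_mul, det_transpose]

theorem IsCholesky.det_ne_zero {U A : Mat p} (h : IsCholesky U A) (hA : A.PosDef) : U.det ≠ 0 :=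
  fun h0 => hA.det_pos.ne (by rw [← h.det_mul_self, h0, zero_mul])

theorem IsCholesky.abs_det {U A : Mat p} (h : IsCholesky U A) :
    |U.det| = A.det ^ (1 / 2 : ℝ) := by
  rw [← h.det_mul_self, ← Real.sqrt_eq_rpow, Real.sqrt_mul_self_eq_abs]

/-! ### Rank one matrices and the singular multivariate beta distribution -/

/-- Polar coordinates in `ℝ^p`. -/
theorem lintegral_polar (hp : 1 ≤ p) {f : Vec p → ℝ≥0∞} (hf : Measurable f) :
    ∫⁻ v, f v = ∫⁻ h,
      (∫⁻ r in Set.Ioi (0 : ℝ), ENNReal.ofReal (r ^ (p - 1)) * f (r • (h : Vec p)))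
      ∂(volume : Measure (Vec p)).toSphere := by
  have : Nonempty (Fin p) := ⟨⟨0, hp⟩⟩
  have hmp := (volume : Measure (Vec p)).measurePreserving_homeomorphUnitSphereProd
  have hfin : Module.finrank ℝ (Vec p) = p := by simp
  rw [hfin] at hmp
  calc ∫⁻ v, f v = ∫⁻ v in ({0}ᶜ : Set (Vec p)), f v := by rw [restrict_compl_singleton]
    _ = ∫⁻ v : ({0}ᶜ : Set (Vec p)), f v ∂(Measure.comap Subtype.val volume) :=
        (lintegral_subtype_comap (measurableSet_singleton _).compl _).symm
    _ = ∫⁻ v : ({0}ᶜ : Set (Vec p)), (fun q : Metric.sphere (0 : Vec p) 1 × Set.Ioi (0 : ℝ) =>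
          f ((q.2 : ℝ) • (q.1 : Vec p))) (homeomorphUnitSphereProd (Vec p) v)
            ∂(Measure.comap Subtype.val volume) := by
        refine lintegral_congr fun v => ?_
        have hv : (v : Vec p) ≠ 0 := v.2
        simp [smul_smul, hv]
    _ = ∫⁻ q, f ((q.2 : ℝ) • (q.1 : Vec p))
          ∂((volume : Measure (Vec p)).toSphere.prod (Measure.volumeIoiPow (p - 1))) :=
        hmp.lintegral_comp (f := fun q : Metric.sphere (0 : Vec p) 1 × Set.Ioi (0 : ℝ) =>
          f ((q.2 : ℝ) • (q.1 : Vec p))) (by fun_prop)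
    _ = ∫⁻ h, (∫⁻ r : Set.Ioi (0 : ℝ), f ((r : ℝ) • (h : Vec p)) ∂(Measure.volumeIoiPow (p - 1)))
          ∂(volume : Measure (Vec p)).toSphere := lintegral_prod _ (by fun_prop)
    _ = _ := by
        refine lintegral_congr fun h => ?_
        rw [Measure.volumeIoiPow, lintegral_withDensity_eq_lintegral_mul _ (by fun_prop) (by fun_prop)]
        simp only [Pi.mul_apply]
        exact lintegral_subtype_comap (μ := volume) measurableSet_Ioi
          (fun r : ℝ => ENNReal.ofReal (r ^ (p - 1)) * f (r • (h : Vec p)))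

theorem lintegral_Ioi_sq (f : ℝ → ℝ≥0∞) :
    ∫⁻ l in Set.Ioi (0 : ℝ), f l
      = ∫⁻ r in Set.Ioi (0 : ℝ), ENNReal.ofReal (2 * r) * f (r ^ 2) := by
  have himage : (fun r : ℝ => r ^ 2) '' Set.Ioi 0 = Set.Ioi 0 := by
    ext x
    constructor
    · rintro ⟨r, hr, rfl⟩
      exact pow_pos (Set.mem_Ioi.1 hr) 2
    · intro hx
      exact ⟨√x, Real.sqrt_pos.2 hx, Real.sq_sqrt (le_of_lt hx)⟩
  have hinj : Set.InjOn (fun r : ℝ => r ^ 2) (Set.Ioi 0) := fun a ha b hb h =>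
    (pow_left_inj₀ (le_of_lt ha) (le_of_lt hb) two_ne_zero).1 h
  have key := lintegral_image_eq_lintegral_abs_deriv_mul (f := fun r : ℝ => r ^ 2)
    (f' := fun r => 2 * r) measurableSet_Ioi
    (fun x _ => by simpa using (hasDerivAt_pow 2 x).hasDerivWithinAt) hinj f
  rw [himage] at key
  rw [key]
  refine setLIntegral_congr_fun measurableSet_Ioi fun r hr => ?_
  have : (0 : ℝ) < 2 * r := mul_pos two_pos hr
  simp only [abs_of_pos this]

theorem measurable_vecMulVec : Measurable fun v : Vec p => vecMulVec v.ofLp v.ofLp :=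
  Continuous.measurable (by
    refine continuous_matrix fun i j => ?_
    simp only [vecMulVec_apply]
    fun_prop)

/-- The volume element on rank one matrices is the image of `|v| ^ p dv` under `v ↦ v v'`. -/
theorem lintegral_rankOneVolume (hp : 1 ≤ p) {f : Mat p → ℝ≥0∞} (hf : Measurable f) :
    ∫⁻ X, f X ∂rankOneVolume p
      = ∫⁻ v : Vec p, ENNReal.ofReal (‖v‖ ^ p) * f (vecMulVec v.ofLp v.ofLp) := by
  have hm1 : Measurable fun q : ℝ × Metric.sphere (0 : Vec p) 1 =>
      q.1 • vecMulVec (fun i => (q.2 : Vec p) i) (fun i => (q.2 : Vec p) i) := by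
    refine measurable_of_entries fun i j => ?_
    simp only [Matrix.smul_apply, vecMulVec_apply, smul_eq_mul]
    fun_prop
  have hm2 := measurable_vecMulVec (p := p)
  rw [rankOneVolume, lintegral_map hf hm1,
    lintegral_withDensity_eq_lintegral_mul _ (by fun_prop) (by fun_prop)]
  rw [lintegral_prod_symm _ (by fun_prop)]
  rw [lintegral_polar hp (by fun_prop)]
  refine lintegral_congr fun h => ?_
  simp only [Pi.mul_apply]
  rw [lintegral_Ioi_sq]
  refine setLIntegral_congr_fun measurableSet_Ioi fun r (hr : 0 < r) => ?_
  have hh : ‖(h : Vec p)‖ = 1 := by simp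
  have hv : vecMulVec (r • (h : Vec p)).ofLp (r • (h : Vec p)).ofLp
      = r ^ 2 • vecMulVec (fun i => (h : Vec p) i) (fun i => (h : Vec p) i) := by
    ext i j
    simp [vecMulVec_apply]
    ring
  simp only [hv, norm_smul, hh, mul_one, Real.norm_of_nonneg hr.le]
  rw [← mul_assoc, ← mul_assoc, ← ENNReal.ofReal_mul (by positivity),
    ← ENNReal.ofReal_mul (by positivity)]
  congr 2
  obtain ⟨q, rfl⟩ := Nat.exists_eq_add_of_le hp
  simp only [Nat.add_sub_cancel_left]
  ring

theorem trace_vecMulVec_self (v : Vec p) : (vecMulVec v.ofLp v.ofLp).trace = ‖v‖ ^ 2 := by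
  rw [EuclideanSpace.real_norm_sq_eq]
  simp [Matrix.trace, vecMulVec_apply, pow_two]

/-- The singular multivariate beta distribution as the law of `I - v v'`, where `v` has density
proportional to `|I - v v'| ^ ((m - p - 1) / 2)` on the open unit ball. -/
theorem lintegral_singularBeta (hp : 1 ≤ p) (m : ℝ) {f : Mat p → ℝ≥0∞} (hf : Measurable f) :
    ∫⁻ B, f B ∂singularBeta p m = ∫⁻ v : Vec p, {B : Mat p | B.PosDef}.indicator
      (fun B => ENNReal.ofReal (Real.pi ^ (-(p : ℝ) / 2) *
        (multiGamma p ((m + 1) / 2) / multiGamma p (m / 2)) * B.det ^ ((m - p - 1) / 2)) * f B)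
      (1 - vecMulVec v.ofLp v.ofLp) := by
  have : Nonempty (Fin p) := ⟨⟨0, hp⟩⟩
  have hsub : Measurable fun X : Mat p => 1 - X := Continuous.measurable (by fun_prop)
  have htr : Measurable fun X : Mat p => X.trace := Continuous.measurable (by fun_prop)
  have hdet := measurable_det (p := p)
  have hdens : Measurable ({B : Mat p | B.PosDef}.indicator fun B => ENNReal.ofReal
      (Real.pi ^ (-(p : ℝ) / 2) * (multiGamma p ((m + 1) / 2) / multiGamma p (m / 2)) *
        (1 - B).trace ^ (-(p : ℝ) / 2) * B.det ^ ((m - p - 1) / 2))) := by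
    refine Measurable.indicator ?_ measurableSet_posDef
    fun_prop
  rw [singularBeta, lintegral_withDensity_eq_lintegral_mul _ hdens hf,
    lintegral_map (hdens.mul hf) hsub]
  refine (lintegral_rankOneVolume hp ((hdens.mul hf).comp hsub)).trans (lintegral_congr_ae ?_)
  -- off the origin the factor `|v| ^ p` cancels the power `K ^ (-p / 2)` of the trace
  have h0 : ∀ᵐ v : Vec p, v ≠ 0 := by
    simp [ae_iff]
  filter_upwards [h0] with v hv
  by_cases hB : (1 - vecMulVec v.ofLp v.ofLp).PosDef
  · have hB' : 1 - vecMulVec v.ofLp v.ofLp ∈ {B : Mat p | B.PosDef} := hB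
    have hn : 0 < ‖v‖ := norm_pos_iff.2 hv
    have hpow : (‖v‖ ^ 2) ^ (-(p : ℝ) / 2) = (‖v‖ ^ p)⁻¹ := by
      rw [← Real.rpow_natCast ‖v‖ 2, ← Real.rpow_mul hn.le, ← Real.rpow_natCast ‖v‖ p,
        ← Real.rpow_neg hn.le]
      congr 1
      push_cast
      ring
    simp only [Function.comp_apply, Pi.mul_apply, Set.indicator_of_mem hB', sub_sub_cancel, trace_vecMulVec_self, hpow]
    rw [← mul_assoc, ← ENNReal.ofReal_mul (by positivity)]
    congr 2
    field_simp
  · have hB' : 1 - vecMulVec v.ofLp v.ofLp ∉ {B : Mat p | B.PosDef} := hB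
    simp only [Function.comp_apply, Pi.mul_apply, Set.indicator_of_notMem hB', zero_mul, mul_zero]

/-! ### Linear substitutions and Gaussian integrals -/

/-- Change of variables `x ↦ T x` on `ℝ^p`. -/
theorem lintegral_mulVec (T : Mat p) (hT : T.det ≠ 0) {f : Vec p → ℝ≥0∞} (hf : Measurable f) :
    ENNReal.ofReal |T.det| * ∫⁻ x : Vec p, f (WithLp.toLp 2 (T *ᵥ x.ofLp)) = ∫⁻ x, f x := by
  have hmp' := PiLp.volume_preserving_ofLp (Fin p)
  have h1 : ∫⁻ x : Vec p, f (WithLp.toLp 2 (T *ᵥ x.ofLp))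
      = ∫⁻ x : Fin p → ℝ, f (WithLp.toLp 2 (T *ᵥ x)) :=
    hmp'.lintegral_comp (f := fun x : Fin p → ℝ => f (WithLp.toLp 2 (T *ᵥ x))) (by fun_prop)
  have h2 : ∫⁻ x : Vec p, f x = ∫⁻ x : Fin p → ℝ, f (WithLp.toLp 2 x) :=
    hmp'.lintegral_comp (f := fun x : Fin p → ℝ => f (WithLp.toLp 2 x)) (by fun_prop)
  have h3 := Real.map_matrix_volume_pi_eq_smul_volume_pi hT
  have h4 : ∫⁻ x : Fin p → ℝ, f (WithLp.toLp 2 (T *ᵥ x))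
      = ∫⁻ x, f (WithLp.toLp 2 x) ∂(Measure.map (toLin' T) volume) := by
    rw [lintegral_map (by fun_prop) (LinearMap.continuous_of_finiteDimensional _).measurable]
    simp only [toLin'_apply]
  rw [h1, h2, h4, h3, lintegral_smul_measure, smul_eq_mul, ← mul_assoc,
    ← ENNReal.ofReal_mul (abs_nonneg _), ← abs_mul, mul_inv_cancel₀ hT]
  simp

theorem trace_mul_vecMulVec (S : Mat p) (x y : Fin p → ℝ) :
    (S * vecMulVec x y).trace = y ⬝ᵥ S *ᵥ x := by
  rw [Matrix.mul_vecMulVec, Matrix.trace_vecMulVec, dotProduct_comm]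

theorem lintegral_gaussian_one (p : ℕ) :
    ∫⁻ x : Vec p, ENNReal.ofReal (Real.exp (-‖x‖ ^ 2 / 2))
      = ENNReal.ofReal ((2 * Real.pi) ^ ((p : ℝ) / 2)) := by
  have h := GaussianFourier.integral_rexp_neg_mul_sq_norm (V := Vec p) (b := 1 / 2) (by norm_num)
  have h' : ∀ x : Vec p, Real.exp (-(1 / 2) * ‖x‖ ^ 2) = Real.exp (-‖x‖ ^ 2 / 2) := fun x => by
    congr 1; ring
  simp_rw [h'] at h
  rw [← ofReal_integral_eq_lintegral_ofReal _ (Filter.Eventually.of_forall fun _ => by positivity), h]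
  · congr 2
    · ring
    · simp
  · by_contra hcon
    rw [integral_undef hcon] at h
    have : 0 < (Real.pi / (1 / 2)) ^ ((Module.finrank ℝ (Vec p) : ℝ) / 2) := by positivity
    exact this.ne h

/-- The Gaussian integral of `exp (-x' S x / 2)`, reduced to `S = I` by `S = U' U`. -/
theorem lintegral_gaussian {S : Mat p} (hS : S.PosDef) :
    ∫⁻ x : Vec p, ENNReal.ofReal (Real.exp (-(S * vecMulVec x.ofLp x.ofLp).trace / 2))
      = ENNReal.ofReal ((2 * Real.pi) ^ ((p : ℝ) / 2) * S.det ^ (-(1 / 2 : ℝ))) := by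
  have hU := isCholesky_choleskyUpper hS
  set U := choleskyUpper S
  have hU0 := hU.det_ne_zero hS
  have key := lintegral_mulVec U hU0 (f := fun x => ENNReal.ofReal (Real.exp (-‖x‖ ^ 2 / 2)))
    (by fun_prop)
  have h1 : ∀ x : Vec p, ‖(WithLp.toLp 2 (U *ᵥ x.ofLp) : Vec p)‖ ^ 2
      = (S * vecMulVec x.ofLp x.ofLp).trace := fun x => by
    rw [trace_mul_vecMulVec, ← hU.2.2, EuclideanSpace.real_norm_sq_eq, ← Matrix.mulVec_mulVec,
      Matrix.dotProduct_mulVec, Matrix.vecMul_transpose]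
    simp [dotProduct, pow_two]
  simp only [h1, lintegral_gaussian_one] at key
  rw [hU.abs_det] at key
  have hSd := hS.det_pos
  have h2 : ENNReal.ofReal (S.det ^ (1 / 2 : ℝ)) ≠ 0 := by
    simp only [ne_eq, ENNReal.ofReal_eq_zero, not_le]; positivity
  rw [← ENNReal.mul_right_inj h2 ENNReal.ofReal_ne_top, key, ← ENNReal.ofReal_mul (by positivity),
    Real.rpow_neg hSd.le]
  congr 1
  have : S.det ^ (1 / 2 : ℝ) ≠ 0 := by positivity
  field_simp

/-- The standard Gaussian measure has density `(2π) ^ (-p/2) exp (-|x|² / 2)`. -/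
theorem stdGaussian_eq_withDensity (p : ℕ) : stdGaussian (Vec p) = volume.withDensity
    fun x => ENNReal.ofReal ((2 * Real.pi) ^ (-(p : ℝ) / 2) * Real.exp (-‖x‖ ^ 2 / 2)) := by
  have hfin : IsFiniteMeasure ((volume : Measure (Vec p)).withDensity
      fun x => ENNReal.ofReal ((2 * Real.pi) ^ (-(p : ℝ) / 2) * Real.exp (-‖x‖ ^ 2 / 2))) := by
    refine isFiniteMeasure_withDensity ?_
    simp_rw [ENNReal.ofReal_mul (show 0 ≤ (2 * Real.pi) ^ (-(p : ℝ) / 2) by positivity)]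
    rw [lintegral_const_mul _ (by fun_prop), lintegral_gaussian_one]
    exact ENNReal.mul_ne_top ENNReal.ofReal_ne_top ENNReal.ofReal_ne_top
  -- both characteristic functions are `exp (-|t|² / 2)`
  refine Measure.ext_of_charFun ?_
  ext t
  rw [charFun_stdGaussian, charFun_apply, integral_withDensity_eq_integral_toReal_smul (by fun_prop)
    (Filter.Eventually.of_forall fun _ => ENNReal.ofReal_lt_top)]
  have h := GaussianFourier.integral_cexp_neg_mul_sq_norm_add (V := Vec p) (b := 1 / 2)
    (by norm_num) Complex.I t
  have h1 : ∀ x : Vec p, (ENNReal.ofReal ((2 * Real.pi) ^ (-(p : ℝ) / 2) *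
      Real.exp (-‖x‖ ^ 2 / 2))).toReal • Complex.exp (inner ℝ x t * Complex.I)
      = ((2 * Real.pi) ^ (-(p : ℝ) / 2) : ℝ) *
        Complex.exp (-(1 / 2) * ‖x‖ ^ 2 + Complex.I * inner ℝ t x) := fun x => by
    rw [ENNReal.toReal_ofReal (by positivity), Complex.real_smul, Complex.ofReal_mul, mul_assoc,
      Complex.ofReal_exp, ← Complex.exp_add, real_inner_comm]
    congr 2
    push_cast
    ring
  simp_rw [h1]
  rw [integral_const_mul, h]
  have h2 : (Real.pi / (1 / 2) : ℂ) ^ ((Module.finrank ℝ (Vec p) : ℂ) / 2)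
      = ((2 * Real.pi) ^ ((p : ℝ) / 2) : ℝ) := by
    rw [Complex.ofReal_cpow (by positivity)]
    congr 1
    · push_cast; ring
    · simp
  rw [h2, ← mul_assoc, ← Complex.ofReal_mul, ← Real.rpow_add (by positivity)]
  have h3 : -(p : ℝ) / 2 + p / 2 = 0 := by ring
  rw [h3, Real.rpow_zero, Complex.ofReal_one, one_mul]
  congr 1
  simp
  ring

/-! ### The inverted Wishart distribution -/

theorem posDef_cong_iff {A X : Mat p} (hA : A.det ≠ 0) : (A * X * Aᵀ).PosDef ↔ X.PosDef := by
  have hu : IsUnit A := (Matrix.isUnit_iff_isUnit_det _).2 (isUnit_iff_ne_zero.2 hA)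
  have h := hu.posDef_star_right_conjugate_iff (x := X)
  rwa [Matrix.star_eq_conjTranspose, Matrix.conjTranspose_eq_transpose_of_trivial] at h

theorem posDef_cong_iff' {A X : Mat p} (hA : A.det ≠ 0) : (Aᵀ * X * A).PosDef ↔ X.PosDef := by
  have h := posDef_cong_iff (A := Aᵀ) (X := X) (by rwa [det_transpose])
  rwa [transpose_transpose] at h

theorem isSymm_of_posDef {X : Mat p} (hX : X.PosDef) : X.IsSymm := by
  have := hX.1
  rwa [Matrix.IsHermitian, Matrix.conjTranspose_eq_transpose_of_trivial] at this

theorem multiGamma_nonneg (p : ℕ) (a : ℝ) : 0 ≤ multiGamma p a := by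
  refine setIntegral_nonneg measurableSet_posDef fun X (hX : X.PosDef) => ?_
  have := hX.det_pos
  positivity

/-- The factor of the density of `IW_p(ν, S)` that does not depend on the argument. -/
noncomputable def iwConst (ν : ℝ) (S : Mat p) : ℝ :=
  S.det ^ ((ν - p - 1) / 2) / (2 ^ ((p : ℝ) * (ν - p - 1) / 2) * multiGamma p ((ν - p - 1) / 2))

theorem iwConst_nonneg (ν : ℝ) {S : Mat p} (hS : S.PosDef) : 0 ≤ iwConst ν S := by
  have := hS.det_pos
  have := multiGamma_nonneg p ((ν - p - 1) / 2)
  unfold iwConst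
  positivity

theorem invWishartDensity_eq (ν : ℝ) (S : Mat p) {X : Mat p} (hX : X.PosDef) :
    invWishartDensity ν S X
      = iwConst ν S * (Real.exp (-(S * X⁻¹).trace / 2) * X.det ^ (-(ν / 2))) := by
  rw [invWishartDensity, iwConst, Real.rpow_neg hX.det_pos.le]
  ring

theorem measurable_invWishartDensity {α : Type*} [MeasurableSpace α] (ν : ℝ) {S X : α → Mat p}
    (hS : Measurable S) (hX : Measurable X) :
    Measurable fun a => invWishartDensity ν (S a) (X a) := by
  unfold invWishartDensity
  have h1 : Measurable fun a => (S a).det := measurable_det.comp hS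
  have h2 : Measurable fun a => (X a).det := measurable_det.comp hX
  have h3 : Measurable fun a => (S a * (X a)⁻¹).trace := by
    simp only [Matrix.trace, Matrix.diag_apply, Matrix.mul_apply]
    refine Finset.measurable_sum _ fun i _ => Finset.measurable_sum _ fun j _ => Measurable.mul ?_ ?_
    · exact (measurable_entry i j).comp hS
    · exact ((measurable_entry j i).comp measurable_inv).comp hX
  fun_prop

theorem lintegral_invWishart (ν : ℝ) (S : Mat p) (f : Mat p → ℝ≥0∞) :
    ∫⁻ X, f X ∂invWishart ν S = ∫⁻ X in {X : Mat p | X.PosDef},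
      ENNReal.ofReal (invWishartDensity ν S X) * f X ∂symVolume p := by
  rw [invWishart, withDensity_indicator measurableSet_posDef,
    lintegral_withDensity_eq_lintegral_mul_non_measurable]
  · rfl
  · exact (measurable_invWishartDensity ν measurable_const measurable_id).ennreal_ofReal
  · exact Filter.Eventually.of_forall fun _ => ENNReal.ofReal_lt_top

theorem ae_posDef_invWishart (ν : ℝ) (S : Mat p) : ∀ᵐ X ∂invWishart ν S, X.PosDef := by
  rw [invWishart, withDensity_indicator measurableSet_posDef]
  exact (withDensity_absolutelyContinuous _ _).ae_le
    (ae_restrict_mem (μ := symVolume p) measurableSet_posDef)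

/-- The law of `X⁻¹` for `X ∼ IW_p(ν, S)`: a Wishart density. -/
theorem lintegral_invWishart_inv (ν : ℝ) {S : Mat p} (hS : S.PosDef) (f : Mat p → ℝ≥0∞) :
    ∫⁻ X, f X ∂invWishart ν S = ∫⁻ W in {W : Mat p | W.PosDef},
      ENNReal.ofReal (iwConst ν S * (Real.exp (-(S * W).trace / 2) * W.det ^ (ν / 2 - p - 1)))
        * f W⁻¹ ∂symVolume p := by
  rw [lintegral_invWishart, ← lintegral_symVolume_inv]
  refine setLIntegral_congr_fun measurableSet_posDef fun W (hW : W.PosDef) => ?_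
  have hd := hW.det_pos
  have hc := iwConst_nonneg ν hS
  rw [← mul_assoc, ← ENNReal.ofReal_mul (by positivity)]
  congr 2
  rw [invWishartDensity_eq _ _ hW.inv, Matrix.nonsing_inv_nonsing_inv _ (isUnit_iff_ne_zero.2 hd.ne'),
    Matrix.det_nonsing_inv, Ring.inverse_eq_inv', Real.inv_rpow hd.le, ← Real.rpow_neg hd.le, neg_neg,
    ← Real.rpow_natCast, ← Real.rpow_neg hd.le, sub_sub, sub_eq_neg_add, Real.rpow_add hd]
  push_cast
  ring

/-- If `X ∼ IW_p(ν, S)` then `A X A' ∼ IW_p(ν, A S A')`. -/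
theorem lintegral_invWishart_cong (ν : ℝ) (S : Mat p) (hS : S.PosDef) {A : Mat p}
    (hA : A.det ≠ 0) (f : Mat p → ℝ≥0∞) :
    ∫⁻ X, f (A * X * Aᵀ) ∂invWishart ν S = ∫⁻ X, f X ∂invWishart ν (A * S * Aᵀ) := by
  symm
  rw [lintegral_invWishart, lintegral_invWishart, ← lintegral_indicator measurableSet_posDef,
    ← lintegral_indicator measurableSet_posDef, ← lintegral_symVolume_cong _ hA,
    ← lintegral_const_mul' _ _ ENNReal.ofReal_ne_top]
  refine lintegral_congr fun X => ?_
  by_cases hX : X.PosDef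
  · have hX' : A * X * Aᵀ ∈ {X : Mat p | X.PosDef} := (posDef_cong_iff hA).2 hX
    have hX1 : X ∈ {X : Mat p | X.PosDef} := hX
    rw [Set.indicator_of_mem hX', Set.indicator_of_mem hX1, ← mul_assoc,
      ← ENNReal.ofReal_mul (by positivity)]
    congr 2
    have hXd := hX.det_pos
    have hSd := hS.det_pos
    have hAd : 0 < |A.det| := abs_pos.2 hA
    have hdet : ∀ Y : Mat p, (A * Y * Aᵀ).det = |A.det| ^ (2 : ℝ) * Y.det := fun Y => by
      rw [det_mul, det_mul, det_transpose, Real.rpow_two, sq_abs]; ring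
    have htr : (A * S * Aᵀ * (A * X * Aᵀ)⁻¹).trace = (S * X⁻¹).trace := by
      have hu : IsUnit A.det := isUnit_iff_ne_zero.2 hA
      have hut : IsUnit (Aᵀ).det := by rwa [det_transpose]
      have : A * S * Aᵀ * (A * X * Aᵀ)⁻¹ = A * (S * X⁻¹) * A⁻¹ := by
        rw [Matrix.mul_inv_rev, Matrix.mul_inv_rev, ← Matrix.mul_assoc, Matrix.mul_assoc (A * S),
          Matrix.mul_nonsing_inv _ hut, Matrix.mul_one]
        simp only [Matrix.mul_assoc]
      rw [this, Matrix.trace_mul_comm, ← Matrix.mul_assoc, Matrix.nonsing_inv_mul _ hu,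
        Matrix.one_mul]
    rw [invWishartDensity_eq _ _ hX, invWishartDensity_eq _ _ hX', htr, iwConst, iwConst, hdet, hdet,
      Real.mul_rpow (by positivity) hSd.le, Real.mul_rpow (by positivity) hXd.le,
      ← Real.rpow_mul hAd.le, ← Real.rpow_mul hAd.le]
    have hpow : |A.det| ^ (p + 1) * (|A.det| ^ (2 * ((ν - p - 1) / 2)) * |A.det| ^ (2 * (-(ν / 2))))
        = 1 := by
      rw [← Real.rpow_natCast, ← Real.rpow_add hAd, ← Real.rpow_add hAd]
      have : ((p + 1 : ℕ) : ℝ) + (2 * ((ν - p - 1) / 2) + 2 * (-(ν / 2))) = 0 := by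
        push_cast; ring
      rw [this, Real.rpow_zero]
    linear_combination (S.det ^ ((ν - p - 1) / 2) /
      (2 ^ ((p : ℝ) * (ν - p - 1) / 2) * multiGamma p ((ν - p - 1) / 2)) *
      (Real.exp (-(S * X⁻¹).trace / 2) * X.det ^ (-(ν / 2)))) * hpow
  · have hX' : A * X * Aᵀ ∉ {X : Mat p | X.PosDef} := fun h => hX ((posDef_cong_iff hA).1 h)
    have hX1 : X ∉ {X : Mat p | X.PosDef} := hX
    rw [Set.indicator_of_notMem hX', Set.indicator_of_notMem hX1, mul_zero]

/-- Any two positive definite matrices are congruent, so that the total mass of `IW_p(ν, S)` does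
not depend on `S`. -/
theorem isProbabilityMeasure_invWishart {ν : ℝ} {S₀ : Mat p} (hS₀ : S₀.PosDef)
    (h : IsProbabilityMeasure (invWishart ν S₀)) {S : Mat p} (hS : S.PosDef) :
    IsProbabilityMeasure (invWishart ν S) := by
  have h0 := isCholesky_choleskyUpper hS₀
  have h1 := isCholesky_choleskyUpper hS
  set U := choleskyUpper S₀
  set V := choleskyUpper S
  have hU : IsUnit U.det := isUnit_iff_ne_zero.2 (h0.det_ne_zero hS₀)
  have hUt : IsUnit (Uᵀ).det := by rwa [det_transpose]
  have hA : (Vᵀ * (Uᵀ)⁻¹).det ≠ 0 := by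
    rw [det_mul, det_transpose, Matrix.det_nonsing_inv, det_transpose, Ring.inverse_eq_inv']
    exact mul_ne_zero (h1.det_ne_zero hS) (inv_ne_zero (h0.det_ne_zero hS₀))
  have hAS : Vᵀ * (Uᵀ)⁻¹ * S₀ * (Vᵀ * (Uᵀ)⁻¹)ᵀ = S := by
    rw [← h0.2.2, ← h1.2.2, transpose_mul, transpose_transpose, Matrix.transpose_nonsing_inv,
      transpose_transpose]
    calc Vᵀ * (Uᵀ)⁻¹ * (Uᵀ * U) * (U⁻¹ * V) = Vᵀ * ((Uᵀ)⁻¹ * Uᵀ) * (U * U⁻¹) * V := by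
          simp only [Matrix.mul_assoc]
      _ = Vᵀ * V := by
          rw [Matrix.nonsing_inv_mul _ hUt, Matrix.mul_nonsing_inv _ hU, Matrix.mul_one,
            Matrix.mul_one]
  have key := lintegral_invWishart_cong ν S₀ hS₀ hA fun _ => 1
  rw [hAS, lintegral_one, lintegral_one, measure_univ] at key
  exact ⟨key.symm⟩

/-- If the normalising constant `Γ_p` were zero, the density, a quotient by zero, would vanish. -/
theorem multiGamma_ne_zero_of_isProbabilityMeasure {ν : ℝ} {S : Mat p}
    (h : IsProbabilityMeasure (invWishart ν S)) : multiGamma p ((ν - p - 1) / 2) ≠ 0 := by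
  intro h0
  have : invWishart ν S = 0 := by
    unfold invWishart invWishartDensity
    simp [h0]
  exact IsProbabilityMeasure.ne_zero _ this

/-! ### Mean of the inverse -/

theorem det_one_sub_smul_vecMulVec (c : ℝ) (g : Fin p → ℝ) :
    (1 - c • vecMulVec g g).det = 1 - c * (g ⬝ᵥ g) := by
  have h := det_one_add_replicateCol_mul_replicateRow (ι := Unit) (-c • g) g
  rw [← Matrix.vecMulVec_eq, Matrix.smul_vecMulVec, dotProduct_smul] at h
  rw [sub_eq_add_neg, ← neg_smul, h, smul_eq_mul]
  ring

theorem posDef_one_sub_smul_vecMulVec {c : ℝ} {g : Fin p → ℝ} (hc : c * (g ⬝ᵥ g) < 1) :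
    (1 - c • vecMulVec g g).PosDef := by
  refine Matrix.PosDef.of_dotProduct_mulVec_pos ?_ fun x hx => ?_
  · rw [Matrix.IsHermitian, Matrix.conjTranspose_eq_transpose_of_trivial]
    ext i j
    simp [vecMulVec_apply, Matrix.one_apply, mul_comm, eq_comm]
  · have hxx : 0 < x ⬝ᵥ x := by
      have := (dotProduct_star_self_pos_iff (v := x)).2 hx
      simpa using this
    have hcs : (g ⬝ᵥ x) ^ 2 ≤ (g ⬝ᵥ g) * (x ⬝ᵥ x) := by
      have := Finset.sum_mul_sq_le_sq_mul_sq Finset.univ g x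
      simpa [dotProduct, pow_two] using this
    have hval : star x ⬝ᵥ (1 - c • vecMulVec g g) *ᵥ x = x ⬝ᵥ x - c * (g ⬝ᵥ x) ^ 2 := by
      rw [Matrix.sub_mulVec, Matrix.one_mulVec, Matrix.smul_mulVec, Matrix.vecMulVec_mulVec,
        dotProduct_sub, dotProduct_smul]
      simp only [star_trivial, smul_eq_mul, op_smul_eq_smul, dotProduct_smul, dotProduct_comm x g]
      ring
    rw [hval]
    rcases le_total c 0 with h | h
    · nlinarith [sq_nonneg (g ⬝ᵥ x)]
    · nlinarith [mul_le_mul_of_nonneg_left hcs h]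

/-- Under `IW_p(ν, S)`, the quadratic form `h' X⁻¹ h` has the moment generating function of a gamma
law. -/
theorem lintegral_exp_quadForm {ν : ℝ} (hν : ∀ S : Mat p, S.PosDef →
      IsProbabilityMeasure (invWishart ν S)) {S : Mat p} (hS : S.PosDef) (h : Fin p → ℝ) {u : ℝ}
    (hu : 2 * u * (h ⬝ᵥ S⁻¹ *ᵥ h) < 1) :
    ∫⁻ X, ENNReal.ofReal (Real.exp (u * (h ⬝ᵥ X⁻¹ *ᵥ h))) ∂invWishart ν S
      = ENNReal.ofReal ((1 - 2 * u * (h ⬝ᵥ S⁻¹ *ᵥ h)) ^ (-((ν - p - 1) / 2))) := by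
  have hU := isCholesky_choleskyUpper hS
  set U := choleskyUpper S
  have hU0 := hU.det_ne_zero hS
  have hUu : IsUnit U.det := isUnit_iff_ne_zero.2 hU0
  have hUt : IsUnit (Uᵀ).det := by rwa [det_transpose]
  set g : Fin p → ℝ := (Uᵀ)⁻¹ *ᵥ h with hg
  have hhg : Uᵀ *ᵥ g = h := by
    rw [hg, Matrix.mulVec_mulVec, Matrix.mul_nonsing_inv _ hUt, Matrix.one_mulVec]
  have hgg : h ⬝ᵥ S⁻¹ *ᵥ h = g ⬝ᵥ g := by
    rw [← hU.2.2, Matrix.mul_inv_rev, ← Matrix.mulVec_mulVec, ← hg, Matrix.dotProduct_mulVec, hg,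
      ← Matrix.transpose_nonsing_inv, Matrix.mulVec_transpose]
  rw [hgg] at hu ⊢
  set T : Mat p := Uᵀ * (1 - (2 * u) • vecMulVec g g) * U with hT
  have hTpd : T.PosDef := (posDef_cong_iff' hU0).2 (posDef_one_sub_smul_vecMulVec hu)
  have hTdet : T.det = S.det * (1 - 2 * u * (g ⬝ᵥ g)) := by
    rw [hT, det_mul, det_mul, det_transpose, det_one_sub_smul_vecMulVec, ← hU.det_mul_self]
    ring
  have hTS : T = S - (2 * u) • vecMulVec h h := by
    rw [hT, Matrix.mul_sub, Matrix.sub_mul, Matrix.mul_one, hU.2.2, Matrix.mul_smul, Matrix.smul_mul,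
      Matrix.mul_vecMulVec, Matrix.vecMulVec_mul, ← Matrix.mulVec_transpose, hhg]
  -- the tilted density is that of `IW_p(ν, T)`, up to the ratio of the constants
  have hmass := (hν T hTpd).measure_univ
  rw [← lintegral_one, lintegral_invWishart] at hmass
  have hpos : 0 < 1 - 2 * u * (g ⬝ᵥ g) := by linarith
  rw [lintegral_invWishart, ← mul_one (ENNReal.ofReal ((1 - 2 * u * (g ⬝ᵥ g)) ^ _)), ← hmass,
    ← lintegral_const_mul' _ _ ENNReal.ofReal_ne_top]
  refine setLIntegral_congr_fun measurableSet_posDef fun X (hX : X.PosDef) => ?_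
  have hSd := hS.det_pos
  have hc := iwConst_nonneg ν hS
  have hXd := hX.det_pos
  rw [mul_one, invWishartDensity_eq _ _ hX, invWishartDensity_eq _ _ hX,
    ← ENNReal.ofReal_mul (by positivity), ← ENNReal.ofReal_mul (by positivity)]
  congr 1
  have hexp : Real.exp (-(T * X⁻¹).trace / 2)
      = Real.exp (-(S * X⁻¹).trace / 2) * Real.exp (u * (h ⬝ᵥ X⁻¹ *ᵥ h)) := by
    rw [← Real.exp_add, hTS, Matrix.sub_mul, Matrix.smul_mul, Matrix.trace_sub, Matrix.trace_smul,
      Matrix.trace_mul_comm (vecMulVec h h), trace_mul_vecMulVec, smul_eq_mul]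
    congr 1
    ring
  have hconst : iwConst ν S = (1 - 2 * u * (g ⬝ᵥ g)) ^ (-((ν - p - 1) / 2)) * iwConst ν T := by
    rw [iwConst, iwConst, hTdet, Real.mul_rpow hSd.le hpos.le, Real.rpow_neg hpos.le]
    have : (1 - 2 * u * (g ⬝ᵥ g)) ^ ((ν - p - 1) / 2) ≠ 0 := by positivity
    field_simp
  rw [hexp, hconst]
  ring

theorem measurable_quadForm (h : Fin p → ℝ) : Measurable fun X : Mat p => h ⬝ᵥ X⁻¹ *ᵥ h := by
  have : Measurable fun X : Mat p => h ⬝ᵥ X *ᵥ h := Continuous.measurable (by fun_prop)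
  exact this.comp measurable_inv

/-- The mean of `h' X⁻¹ h` is the derivative at `0` of its moment generating function. -/
theorem integrable_quadForm_and_integral {ν : ℝ} (hν : ∀ S : Mat p, S.PosDef →
      IsProbabilityMeasure (invWishart ν S)) {S : Mat p} (hS : S.PosDef) (h : Fin p → ℝ) :
    Integrable (fun X : Mat p => h ⬝ᵥ X⁻¹ *ᵥ h) (invWishart ν S) ∧
      ∫ X, h ⬝ᵥ X⁻¹ *ᵥ h ∂invWishart ν S = (ν - p - 1) * (h ⬝ᵥ S⁻¹ *ᵥ h) := by
  have hP := hν S hS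
  set θ := h ⬝ᵥ S⁻¹ *ᵥ h with hθ
  set q : Mat p → ℝ := fun X => h ⬝ᵥ X⁻¹ *ᵥ h with hq
  have hqm : Measurable q := measurable_quadForm h
  have hopen : IsOpen {u : ℝ | 2 * u * θ < 1} := isOpen_lt (by fun_prop) (by fun_prop)
  have hmem : (0 : ℝ) ∈ {u : ℝ | 2 * u * θ < 1} := by simp
  have hsub : {u : ℝ | 2 * u * θ < 1} ⊆ integrableExpSet q (invWishart ν S) := by
    intro u hu
    refine ⟨(Measurable.aestronglyMeasurable (by fun_prop)), ?_⟩
    rw [hasFiniteIntegral_iff_ofReal (Filter.Eventually.of_forall fun _ => (Real.exp_pos _).le),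
      lintegral_exp_quadForm hν hS h hu]
    exact ENNReal.ofReal_lt_top
  have hint : 0 ∈ interior (integrableExpSet q (invWishart ν S)) :=
    interior_mono hsub (by rwa [hopen.interior_eq])
  refine ⟨integrable_of_mem_interior_integrableExpSet hint, ?_⟩
  have hmgf : mgf q (invWishart ν S)
      =ᶠ[nhds 0] fun u => (1 - 2 * u * θ) ^ (-((ν - p - 1) / 2)) := by
    filter_upwards [hopen.mem_nhds hmem] with u hu
    have hpos : 0 < 1 - 2 * u * θ := sub_pos.2 hu
    rw [mgf, integral_eq_lintegral_of_nonneg_ae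
      (Filter.Eventually.of_forall fun _ => (Real.exp_pos _).le)
      (Measurable.aestronglyMeasurable (by fun_prop)), lintegral_exp_quadForm hν hS h hu,
      ENNReal.toReal_ofReal (by positivity)]
  have hder : HasDerivAt (fun u : ℝ => (1 - 2 * u * θ) ^ (-((ν - p - 1) / 2)))
      ((ν - p - 1) * θ) 0 := by
    have h1 : HasDerivAt (fun u : ℝ => 1 - 2 * u * θ) (-(2 * θ)) 0 := by
      have := (((hasDerivAt_id (0 : ℝ)).const_mul 2).mul_const θ).const_sub 1
      simpa using this
    have h2 := h1.rpow_const (p := -((ν - p - 1) / 2)) (Or.inl (by simp))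
    convert h2 using 1
    simp
    ring
  rw [← deriv_mgf_zero hint, hmgf.deriv_eq, hder.deriv]

/-- Polarization: an entry of a symmetric matrix from values of the quadratic form. -/
theorem quadForm_single_add {X : Mat p} (hX : X.IsSymm) (i j : Fin p) :
    X i j = 1 / 2 * ((Pi.single i 1 + Pi.single j 1 : Fin p → ℝ) ⬝ᵥ X *ᵥ
        (Pi.single i 1 + Pi.single j 1) - (Pi.single i 1 : Fin p → ℝ) ⬝ᵥ X *ᵥ Pi.single i 1
      - (Pi.single j 1 : Fin p → ℝ) ⬝ᵥ X *ᵥ Pi.single j 1) := by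
  simp [Matrix.mulVec_add, hX.apply j i]
  ring

/-- The mean of `X⁻¹` under `IW_p(ν, S)` exists and is `(ν - p - 1) S⁻¹`. -/
theorem invIntegrable_and_meanInv {ν : ℝ} (hν : ∀ S : Mat p, S.PosDef →
      IsProbabilityMeasure (invWishart ν S)) {S : Mat p} (hS : S.PosDef) :
    InvIntegrable (invWishart ν S) ∧ meanInv (invWishart ν S) = (ν - p - 1) • S⁻¹ := by
  have key := fun i j : Fin p => show Integrable (fun X : Mat p => X⁻¹ i j) (invWishart ν S) ∧
      ∫ X, X⁻¹ i j ∂invWishart ν S = (ν - p - 1) * S⁻¹ i j by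
    have hae : (fun X : Mat p => X⁻¹ i j) =ᵐ[invWishart ν S] fun X => 1 / 2 *
        ((Pi.single i 1 + Pi.single j 1 : Fin p → ℝ) ⬝ᵥ X⁻¹ *ᵥ (Pi.single i 1 + Pi.single j 1)
          - (Pi.single i 1 : Fin p → ℝ) ⬝ᵥ X⁻¹ *ᵥ Pi.single i 1
          - (Pi.single j 1 : Fin p → ℝ) ⬝ᵥ X⁻¹ *ᵥ Pi.single j 1) := by
      filter_upwards [ae_posDef_invWishart ν S] with X hX
      exact quadForm_single_add (isSymm_of_posDef hX.inv) i j
    obtain ⟨h1, e1⟩ := integrable_quadForm_and_integral hν hS (Pi.single i 1 + Pi.single j 1)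
    obtain ⟨h2, e2⟩ := integrable_quadForm_and_integral hν hS (Pi.single i 1)
    obtain ⟨h3, e3⟩ := integrable_quadForm_and_integral hν hS (Pi.single j 1)
    refine ⟨(((h1.sub h2).sub h3).const_mul _).congr hae.symm, ?_⟩
    have e12 := integral_sub (h1.sub h2) h3
    simp only [Pi.sub_apply] at e12
    rw [integral_congr_ae hae, integral_const_mul, e12, integral_sub h1 h2,
      e1, e2, e3, quadForm_single_add (isSymm_of_posDef hS.inv) i j]
    ring
  refine ⟨fun i j => (key i j).1, ?_⟩
  ext i j
  simpa [meanInv] using (key i j).2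

/-! ### One step of the evolution -/

theorem posDef_add_vecMulVec {A : Mat p} (hA : A.PosDef) (x : Fin p → ℝ) :
    (A + vecMulVec x x).PosDef := by
  have h := Matrix.posSemidef_vecMulVec_self_star x
  rw [star_trivial] at h
  exact hA.add_posSemidef h

theorem isSymm_vecMulVec_self (x : Fin p → ℝ) : (vecMulVec x x).IsSymm := by
  ext i j
  simp [vecMulVec_apply, mul_comm]

/-- For a fixed positive definite `W = U' U` and `B = I - v v'` a singular beta matrix, the
substitution `x = U' v` turns `U' B U` into `W - x x'`. -/
theorem lintegral_singularBeta_cholesky (hp : 1 ≤ p) (m : ℝ) {W : Mat p} (hW : W.PosDef)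
    {f : Mat p → ℝ≥0∞} (hf : Measurable f) :
    ∫⁻ B, f ((choleskyUpper W)ᵀ * B * choleskyUpper W) ∂singularBeta p m
      = ∫⁻ x : Vec p, {A : Mat p | A.PosDef}.indicator (fun A => ENNReal.ofReal
        (Real.pi ^ (-(p : ℝ) / 2) * (multiGamma p ((m + 1) / 2) / multiGamma p (m / 2)) *
          (W.det ^ (-((m - p) / 2)) * A.det ^ ((m - p - 1) / 2))) * f A)
        (W - vecMulVec x.ofLp x.ofLp) := by
  have hU := isCholesky_choleskyUpper hW
  set U := choleskyUpper W
  have hU0 := hU.det_ne_zero hW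
  have hUt0 : (Uᵀ).det ≠ 0 := by rwa [det_transpose]
  have hWd := hW.det_pos
  have hm1 : Measurable fun B : Mat p => Uᵀ * B * U := Continuous.measurable (by fun_prop)
  have hm2 : Measurable fun x : Vec p => W - vecMulVec x.ofLp x.ofLp :=
    (Continuous.measurable (f := fun X : Mat p => W - X) (by fun_prop)).comp measurable_vecMulVec
  have hdet := measurable_det (p := p)
  set C := Real.pi ^ (-(p : ℝ) / 2) * (multiGamma p ((m + 1) / 2) / multiGamma p (m / 2))
  have hC : 0 ≤ C := by
    have := multiGamma_nonneg p ((m + 1) / 2)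
    have := multiGamma_nonneg p (m / 2)
    positivity
  have hF : Measurable ({A : Mat p | A.PosDef}.indicator fun A => ENNReal.ofReal
      (C * (W.det ^ (-((m - p) / 2)) * A.det ^ ((m - p - 1) / 2))) * f A) :=
    Measurable.indicator (by fun_prop) measurableSet_posDef
  refine (lintegral_singularBeta hp m (hf.comp hm1)).trans
    (Eq.trans ?_ (lintegral_mulVec Uᵀ hUt0 (hF.comp hm2)))
  rw [← lintegral_const_mul' _ _ ENNReal.ofReal_ne_top]
  refine lintegral_congr fun v => ?_
  have hA : W - vecMulVec (Uᵀ *ᵥ v.ofLp) (Uᵀ *ᵥ v.ofLp)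
      = Uᵀ * (1 - vecMulVec v.ofLp v.ofLp) * U := by
    rw [Matrix.mul_sub, Matrix.sub_mul, Matrix.mul_one, hU.2.2, Matrix.mul_vecMulVec,
      Matrix.vecMulVec_mul, ← Matrix.mulVec_transpose]
  simp only [Function.comp_apply, hA]
  by_cases hB : (1 - vecMulVec v.ofLp v.ofLp).PosDef
  · have h1 : 1 - vecMulVec v.ofLp v.ofLp ∈ {A : Mat p | A.PosDef} := hB
    have h2 : Uᵀ * (1 - vecMulVec v.ofLp v.ofLp) * U ∈ {A : Mat p | A.PosDef} :=
      (posDef_cong_iff' hU0).2 hB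
    rw [Set.indicator_of_mem h1, Set.indicator_of_mem h2, ← mul_assoc,
      ← ENNReal.ofReal_mul (abs_nonneg _)]
    congr 2
    have hBd := hB.det_pos
    have e : (Uᵀ * (1 - vecMulVec v.ofLp v.ofLp) * U).det
        = W.det * (1 - vecMulVec v.ofLp v.ofLp).det := by
      rw [det_mul, det_mul, det_transpose, ← hU.det_mul_self]; ring
    rw [e, det_transpose, hU.abs_det, Real.mul_rpow hWd.le hBd.le]
    have hpow : W.det ^ (1 / 2 : ℝ) * (W.det ^ (-((m - p) / 2)) * W.det ^ ((m - p - 1) / 2))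
        = 1 := by
      rw [← Real.rpow_add hWd, ← Real.rpow_add hWd]
      have : 1 / 2 + (-((m - p) / 2) + (m - p - 1) / 2) = 0 := by ring
      rw [this, Real.rpow_zero]
    linear_combination -(C * (1 - vecMulVec v.ofLp v.ofLp).det ^ ((m - p - 1) / 2)) * hpow
  · have h1 : 1 - vecMulVec v.ofLp v.ofLp ∉ {A : Mat p | A.PosDef} := hB
    have h2 : Uᵀ * (1 - vecMulVec v.ofLp v.ofLp) * U ∉ {A : Mat p | A.PosDef} :=
      fun h => hB ((posDef_cong_iff' hU0).1 h)
    rw [Set.indicator_of_notMem h1, Set.indicator_of_notMem h2, mul_zero]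

theorem inv_smul_of_posDef {k : ℝ} (hk : 0 < k) {M : Mat p} (hM : M.PosDef) :
    (k • M)⁻¹ = k⁻¹ • M⁻¹ := by
  have := Matrix.inv_smul' (A := M) (Units.mk0 k hk.ne') (isUnit_iff_ne_zero.2 hM.det_pos.ne')
  exact this

theorem measurable_cholesky_conj {α : Type*} [MeasurableSpace α] {W B : α → Mat p}
    (hW : Measurable W) (hB : Measurable B) :
    Measurable fun a => (choleskyUpper (W a))ᵀ * B a * choleskyUpper (W a) := by
  have h : ∀ i j, Measurable fun a => choleskyUpper (W a) i j := fun i j =>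
    ((measurable_entry i j).comp measurable_choleskyUpper).comp hW
  have h' : ∀ i j, Measurable fun a => B a i j := fun i j => (measurable_entry i j).comp hB
  refine measurable_of_entries fun i j => ?_
  simp only [Matrix.mul_apply, Matrix.transpose_apply]
  exact Finset.measurable_sum _ fun a _ => (Finset.measurable_sum _ fun b _ =>
    (h b i).mul (h' b a)).mul (h a j)

/-- The law of `(𝒰(Σ⁻¹)' B 𝒰(Σ⁻¹))⁻¹` for independent `Σ ∼ IW_p(m + p + 2, S)` and
`B ∼ B_p(m/2, 1/2)` is `IW_p(m + p + 1, S)`. With `W = Σ⁻¹`, the pair `(A, x) = (W - x x', x)`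
replaces `(W, v)`: the powers of `|W|` cancel, and `A` and `x` become independent, `x` being
Gaussian. -/
theorem lintegral_invWishart_singularBeta (hp : 1 ≤ p) {m : ℝ}
    (hΓ : multiGamma p ((m + 1) / 2) ≠ 0) {S : Mat p} (hS : S.PosDef) {f : Mat p → ℝ≥0∞}
    (hf : Measurable f) :
    ∫⁻ X, ∫⁻ B, f ((choleskyUpper X⁻¹)ᵀ * B * choleskyUpper X⁻¹)⁻¹ ∂singularBeta p m
        ∂invWishart (m + p + 2) S
      = ∫⁻ X, f X ∂invWishart (m + p + 1) S := by
  have hdet := measurable_det (p := p)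
  have hSd := hS.det_pos
  have hfinv : Measurable fun A : Mat p => f A⁻¹ := hf.comp measurable_inv
  set C := Real.pi ^ (-(p : ℝ) / 2) * (multiGamma p ((m + 1) / 2) / multiGamma p (m / 2)) with hCdef
  set c := iwConst (m + p + 2) S with hc
  have hc0 : 0 ≤ c := iwConst_nonneg _ hS
  have hC0 : 0 ≤ C := by
    have := multiGamma_nonneg p ((m + 1) / 2)
    have := multiGamma_nonneg p (m / 2)
    positivity
  have htr : ∀ T : Mat p, Measurable fun X : Mat p => (T * X).trace := fun T =>
    Continuous.measurable (by fun_prop)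
  have htrS := htr S
  -- `f A⁻¹` times the joint density of `(A, x)`
  set J : Mat p → Vec p → ℝ≥0∞ := fun A x => {A : Mat p | A.PosDef}.indicator (fun A =>
    ENNReal.ofReal (c * C * (Real.exp (-(S * A).trace / 2) * A.det ^ ((m - p - 1) / 2))) * f A⁻¹) A
      * ENNReal.ofReal (Real.exp (-(S * vecMulVec x.ofLp x.ofLp).trace / 2)) with hJ
  have hJm1 : Measurable ({A : Mat p | A.PosDef}.indicator (fun A =>
    ENNReal.ofReal (c * C * (Real.exp (-(S * A).trace / 2) * A.det ^ ((m - p - 1) / 2))) * f A⁻¹)) := by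
    refine Measurable.indicator (Measurable.mul ?_ hfinv) measurableSet_posDef
    fun_prop
  have hJm2 : Measurable fun x : Vec p =>
      ENNReal.ofReal (Real.exp (-(S * vecMulVec x.ofLp x.ofLp).trace / 2)) := by
    have := htrS.comp (measurable_vecMulVec (p := p))
    simp only [Function.comp_def] at this
    fun_prop
  have hsub : Measurable fun q : Mat p × Vec p => q.1 - vecMulVec q.2.ofLp q.2.ofLp := by
    refine measurable_of_entries fun i j => ?_
    have h1 : Measurable fun q : Mat p × Vec p => q.1 i j := (measurable_entry i j).comp measurable_fst
    simp only [Matrix.sub_apply, vecMulVec_apply]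
    fun_prop
  -- for fixed `W` the shock `B` is traded for `x`, and all powers of `|W|` cancel
  have step1 : ∫⁻ X, ∫⁻ B, f ((choleskyUpper X⁻¹)ᵀ * B * choleskyUpper X⁻¹)⁻¹ ∂singularBeta p m
        ∂invWishart (m + p + 2) S
      = ∫⁻ W, (∫⁻ x, J (W - vecMulVec x.ofLp x.ofLp) x) ∂symVolume p := by
    rw [lintegral_invWishart_inv _ hS, ← lintegral_indicator measurableSet_posDef]
    refine lintegral_congr fun W => ?_
    by_cases hW : W.PosDef
    · have hW' : W ∈ {A : Mat p | A.PosDef} := hW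
      have hWd := hW.det_pos
      rw [Set.indicator_of_mem hW', Matrix.nonsing_inv_nonsing_inv _ (isUnit_iff_ne_zero.2 hWd.ne'),
        lintegral_singularBeta_cholesky hp m hW hfinv,
        ← lintegral_const_mul' _ _ ENNReal.ofReal_ne_top]
      refine lintegral_congr fun x => ?_
      simp only [hJ]
      by_cases hA : (W - vecMulVec x.ofLp x.ofLp).PosDef
      · have hA' : W - vecMulVec x.ofLp x.ofLp ∈ {A : Mat p | A.PosDef} := hA
        have hAd := hA.det_pos
        rw [Set.indicator_of_mem hA', Set.indicator_of_mem hA', ← mul_assoc, ← hc, ← hCdef,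
          mul_right_comm (ENNReal.ofReal (c * C * _)),
          ← ENNReal.ofReal_mul (by positivity), ← ENNReal.ofReal_mul (by positivity)]
        congr 2
        have e1 : Real.exp (-(S * W).trace / 2) =
            Real.exp (-(S * (W - vecMulVec x.ofLp x.ofLp)).trace / 2) *
              Real.exp (-(S * vecMulVec x.ofLp x.ofLp).trace / 2) := by
          rw [← Real.exp_add, Matrix.mul_sub, Matrix.trace_sub]
          congr 1
          ring
        have e2 : W.det ^ ((m + p + 2) / 2 - p - 1) * W.det ^ (-((m - p) / 2)) = 1 := by
          rw [← Real.rpow_add hWd]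
          have : (m + p + 2) / 2 - p - 1 + -((m - p) / 2) = 0 := by ring
          rw [this, Real.rpow_zero]
        rw [e1]
        linear_combination (c * C * Real.exp (-(S * (W - vecMulVec x.ofLp x.ofLp)).trace / 2) *
          Real.exp (-(S * vecMulVec x.ofLp x.ofLp).trace / 2) *
          (W - vecMulVec x.ofLp x.ofLp).det ^ ((m - p - 1) / 2)) * e2
      · have hA' : W - vecMulVec x.ofLp x.ofLp ∉ {A : Mat p | A.PosDef} := hA
        rw [Set.indicator_of_notMem hA', Set.indicator_of_notMem hA', mul_zero, zero_mul]
    · have hW' : W ∉ {A : Mat p | A.PosDef} := hW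
      rw [Set.indicator_of_notMem hW', eq_comm, lintegral_eq_zero_iff']
      · refine Filter.Eventually.of_forall fun x => ?_
        have hA' : W - vecMulVec x.ofLp x.ofLp ∉ {A : Mat p | A.PosDef} := fun h => hW (by
          simpa using posDef_add_vecMulVec h x.ofLp)
        simp only [hJ, Set.indicator_of_notMem hA', zero_mul, Pi.zero_apply]
      · exact ((hJm1.comp (hsub.comp measurable_prodMk_left)).mul hJm2).aemeasurable
  -- for fixed `x`, `W ↦ A = W - x x'` is a translation; `A > 0` already forces `W > 0`
  have step2 : ∫⁻ W, (∫⁻ x, J (W - vecMulVec x.ofLp x.ofLp) x) ∂symVolume p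
      = ∫⁻ x, ∫⁻ A, J A x ∂symVolume p := by
    rw [lintegral_lintegral_swap]
    · refine lintegral_congr fun x => ?_
      simp_rw [sub_eq_add_neg]
      exact lintegral_symVolume_add (fun A => J A x) (isSymm_vecMulVec_self x.ofLp).neg
    · exact ((hJm1.comp hsub).mul (hJm2.comp measurable_snd)).aemeasurable
  -- the density is a product, and the integral over `x` is Gaussian
  have step3 : ∫⁻ x, ∫⁻ A, J A x ∂symVolume p
      = (∫⁻ A, {A : Mat p | A.PosDef}.indicator (fun A => ENNReal.ofReal
        (c * C * (Real.exp (-(S * A).trace / 2) * A.det ^ ((m - p - 1) / 2))) * f A⁻¹) A ∂symVolume p)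
        * ENNReal.ofReal ((2 * Real.pi) ^ ((p : ℝ) / 2) * S.det ^ (-(1 / 2 : ℝ))) := by
    rw [← lintegral_gaussian hS, ← lintegral_const_mul _ hJm2]
    refine lintegral_congr fun x => ?_
    exact lintegral_mul_const _ hJm1
  rw [step1, step2, step3, lintegral_invWishart_inv _ hS, lintegral_indicator measurableSet_posDef,
    ← lintegral_mul_const' _ _ ENNReal.ofReal_ne_top]
  refine setLIntegral_congr_fun measurableSet_posDef fun A (hA : A.PosDef) => ?_
  have hAd := hA.det_pos
  rw [mul_right_comm, ← ENNReal.ofReal_mul (by positivity)]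
  congr 2
  have e0 : (m + p + 1) / 2 - p - 1 = (m - p - 1) / 2 := by ring
  have e1 : iwConst (m + p + 1) S
      = c * C * ((2 * Real.pi) ^ ((p : ℝ) / 2) * S.det ^ (-(1 / 2 : ℝ))) := by
    have a1 : (m + p + 1 - p - 1) / 2 = m / 2 := by ring
    have a2 : (m + p + 2 - p - 1) / 2 = (m + 1) / 2 := by ring
    have a3 : (p : ℝ) * (m + p + 1 - p - 1) / 2 = p * m / 2 := by ring
    have a4 : (p : ℝ) * (m + p + 2 - p - 1) / 2 = p * m / 2 + p / 2 := by ring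
    have a5 : S.det ^ ((m + 1) / 2) = S.det ^ (m / 2) * S.det ^ (1 / 2 : ℝ) := by
      rw [← Real.rpow_add hSd]; congr 1; ring
    have a6 : Real.pi ^ (-(p : ℝ) / 2) = (Real.pi ^ ((p : ℝ) / 2))⁻¹ := by
      rw [neg_div, Real.rpow_neg Real.pi_pos.le]
    rw [hc, hCdef, iwConst, iwConst, a1, a2, a3, a4, a5, a6, Real.rpow_neg hSd.le,
      Real.rpow_add two_pos, Real.mul_rpow two_pos.le Real.pi_pos.le]
    have b1 : S.det ^ (1 / 2 : ℝ) ≠ 0 := by positivity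
    have b2 : Real.pi ^ ((p : ℝ) / 2) ≠ 0 := by positivity
    have b3 : (2 : ℝ) ^ ((p : ℝ) / 2) ≠ 0 := by positivity
    have b4 : (2 : ℝ) ^ ((p : ℝ) * m / 2) ≠ 0 := by positivity
    -- if `Γ_p(m / 2) = 0`, both sides are quotients by zero
    by_cases b5 : multiGamma p (m / 2) = 0
    · simp [b5]
    · field_simp
  rw [e0, e1]
  ring

theorem lintegral_invWishart_smul (ν : ℝ) {S : Mat p} (hS : S.PosDef) {c : ℝ} (hc : 0 < c)
    (f : Mat p → ℝ≥0∞) :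
    ∫⁻ X, f (c • X) ∂invWishart ν S = ∫⁻ X, f X ∂invWishart ν (c • S) := by
  have hA : ((√c • 1 : Mat p)).det ≠ 0 := by
    rw [det_smul, det_one, mul_one]
    have := Real.sqrt_pos.2 hc
    positivity
  have h : ∀ X : Mat p, (√c • 1 : Mat p) * X * (√c • 1 : Mat p)ᵀ = c • X := fun X => by
    rw [transpose_smul, transpose_one, Matrix.smul_mul, Matrix.mul_smul, Matrix.one_mul,
      Matrix.mul_one, smul_smul, Real.mul_self_sqrt hc.le]
  have := lintegral_invWishart_cong ν S hS hA f
  simpa only [h] using this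

theorem ae_posDef_singularBeta (p : ℕ) (m : ℝ) : ∀ᵐ B ∂singularBeta p m, B.PosDef := by
  rw [singularBeta, withDensity_indicator measurableSet_posDef]
  exact (withDensity_absolutelyContinuous _ _).ae_le (ae_restrict_mem measurableSet_posDef)

/-- One step of the volatility evolution, with the scale factor `k`. -/
theorem lintegral_evolution (hp : 1 ≤ p) {m k : ℝ} (hk : 0 < k)
    (hΓ : multiGamma p ((m + 1) / 2) ≠ 0) {S : Mat p} (hS : S.PosDef) {f : Mat p → ℝ≥0∞}
    (hf : Measurable f) :
    ∫⁻ X, ∫⁻ B, f (k • ((choleskyUpper X⁻¹)ᵀ * B * choleskyUpper X⁻¹))⁻¹ ∂singularBeta p m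
        ∂invWishart (m + p + 2) S
      = ∫⁻ X, f X ∂invWishart (m + p + 1) (k⁻¹ • S) := by
  have hsm : Measurable fun X : Mat p => k⁻¹ • X := Continuous.measurable (by fun_prop)
  rw [← lintegral_invWishart_smul _ hS (inv_pos.2 hk)]
  refine Eq.trans (lintegral_congr_ae ?_)
    (lintegral_invWishart_singularBeta hp hΓ hS (hf.comp hsm))
  filter_upwards [ae_posDef_invWishart (m + p + 2) S] with X hX
  refine lintegral_congr_ae ?_
  filter_upwards [ae_posDef_singularBeta p m] with B hB
  have hU := isCholesky_choleskyUpper hX.inv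
  rw [inv_smul_of_posDef hk ((posDef_cong_iff' (hU.det_ne_zero hX.inv)).2 hB)]

/-! ### Conditional inverted Wishart laws -/

section Conditional

variable {Ω E : Type*} [MeasurableSpace Ω] [MeasurableSpace E] {P : Measure Ω}

theorem measurable_lintegral_invWishart (ν : ℝ) {S : E → Mat p} (hS : Measurable S)
    {φ : E × Mat p → ℝ≥0∞} (hφ : Measurable φ) :
    Measurable fun z => ∫⁻ X, φ (z, X) ∂invWishart ν (S z) := by
  simp_rw [lintegral_invWishart]
  have h2 : Measurable fun q : E × Mat p => invWishartDensity ν (S q.1) q.2 :=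
    measurable_invWishartDensity ν (hS.comp measurable_fst) measurable_snd
  exact (h2.ennreal_ofReal.mul hφ).lintegral_prod_right'

theorem CondInvWishart.lintegral_eq [IsFiniteMeasure P] {X : Ω → Mat p} {Y : Ω → E} {ν : ℝ}
    {S : E → Mat p} (h : CondInvWishart P X Y ν S) (hX : Measurable X) (hY : Measurable Y)
    {φ : E × Mat p → ℝ≥0∞} (hφ : Measurable φ) :
    ∫⁻ ω, φ (Y ω, X ω) ∂P = ∫⁻ z, ∫⁻ x, φ (z, x) ∂invWishart ν (S z) ∂(P.map Y) := by
  rw [← lintegral_map hφ (hY.prodMk hX), ← compProd_map_condDistrib hX.aemeasurable,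
    Measure.lintegral_compProd hφ]
  refine lintegral_congr_ae ?_
  filter_upwards [h] with z hz
  rw [hz.2]

theorem CondInvWishart.ae_posDef [IsFiniteMeasure P] {X : Ω → Mat p} {Y : Ω → E} {ν : ℝ}
    {S : E → Mat p} (h : CondInvWishart P X Y ν S) (hX : Measurable X) (hY : Measurable Y) :
    ∀ᵐ ω ∂P, (X ω).PosDef := by
  have hm : MeasurableSet {X : Mat p | X.PosDef}ᶜ := measurableSet_posDef.compl
  have hφ : Measurable fun q : E × Mat p =>
      ({X : Mat p | X.PosDef}ᶜ.indicator (fun _ => (1 : ℝ≥0∞)) q.2) :=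
    (measurable_const.indicator hm).comp measurable_snd
  have h1 := h.lintegral_eq hX hY hφ
  have h2 : ∀ z, ∫⁻ x, ({X : Mat p | X.PosDef}ᶜ.indicator (fun _ => (1 : ℝ≥0∞)) x)
      ∂invWishart ν (S z) = 0 := fun z => by
    rw [lintegral_indicator_const hm, one_mul]
    exact ae_posDef_invWishart ν (S z)
  simp only [h2, lintegral_zero] at h1
  replace h1 := (lintegral_eq_zero_iff (hφ.comp (hY.prodMk hX))).1 h1
  filter_upwards [h1] with ω hω
  by_contra hcon
  have : X ω ∈ {X : Mat p | X.PosDef}ᶜ := hcon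
  simp [Set.indicator_of_mem this] at hω

/-- Conditional inverted Wishart laws are recognised by their joint integrals. -/
theorem condInvWishart_of_lintegral [IsFiniteMeasure P] {X : Ω → Mat p} {Y : Ω → E}
    (hX : Measurable X) (hY : Measurable Y) {ν : ℝ}
    (hν : ∀ S : Mat p, S.PosDef → IsProbabilityMeasure (invWishart ν S)) {S : E → Mat p}
    (hS : Measurable S) (hpd : ∀ᵐ z ∂(P.map Y), (S z).PosDef)
    (hjoint : ∀ φ : E × Mat p → ℝ≥0∞, Measurable φ →
      ∫⁻ ω, φ (Y ω, X ω) ∂P = ∫⁻ z, ∫⁻ x, φ (z, x) ∂invWishart ν (S z) ∂(P.map Y)) :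
    CondInvWishart P X Y ν S := by
  classical
  -- `S` is changed to the identity off the positive definite cone, to have a Markov kernel
  set S' : E → Mat p := fun z => if (S z).PosDef then S z else 1 with hS'
  have hS'm : Measurable S' := Measurable.ite (hS measurableSet_posDef) hS measurable_const
  have hS'pd : ∀ z, (S' z).PosDef := fun z => by
    simp only [hS']
    split_ifs with h
    · exact h
    · exact Matrix.PosDef.one
  have heq : ∀ᵐ z ∂(P.map Y), S' z = S z := by
    filter_upwards [hpd] with z hz
    simp [hS', hz]
  let κ : Kernel E (Mat p) :=
    { toFun := fun z => invWishart ν (S' z)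
      measurable' := by
        refine Measure.measurable_of_measurable_coe _ fun s hs => ?_
        have := measurable_lintegral_invWishart ν hS'm
          (φ := fun q => s.indicator (fun _ => 1) q.2)
          ((measurable_const.indicator hs).comp measurable_snd)
        simpa [lintegral_indicator_const hs] using this }
  have : IsMarkovKernel κ := ⟨fun z => hν _ (hS'pd z)⟩
  have hκ : P.map (fun ω => (Y ω, X ω)) = P.map Y ⊗ₘ κ := by
    refine Measure.ext_of_lintegral _ fun φ hφ => ?_
    rw [lintegral_map hφ (hY.prodMk hX), hjoint φ hφ, Measure.lintegral_compProd hφ]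
    refine lintegral_congr_ae ?_
    filter_upwards [heq] with z hz
    change _ = ∫⁻ x, φ (z, x) ∂invWishart ν (S' z)
    rw [hz]
  filter_upwards [condDistrib_ae_eq_of_measure_eq_compProd Y hX.aemeasurable hκ, heq, hpd]
    with z h1 h2 h3
  refine ⟨h3, h1.trans ?_⟩
  change invWishart ν (S' z) = _
  rw [h2]

theorem lintegral_comp_of_indepFun [IsProbabilityMeasure P] {F : Type*} [MeasurableSpace F]
    {Z : Ω → E} {e : Ω → F} (hZ : Measurable Z) (he : Measurable e) {μ : Measure F}
    (hlaw : HasLaw e μ P) (hind : IndepFun e Z P) {φ : E × F → ℝ≥0∞} (hφ : Measurable φ) :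
    ∫⁻ ω, φ (Z ω, e ω) ∂P = ∫⁻ ω, ∫⁻ x, φ (Z ω, x) ∂μ ∂P := by
  have : IsProbabilityMeasure μ := hlaw.isProbabilityMeasure_iff.1 inferInstance
  have h := (indepFun_iff_map_prod_eq_prod_map_map hZ.aemeasurable he.aemeasurable).1 hind.symm
  rw [hlaw.map_eq] at h
  rw [← lintegral_map hφ (hZ.prodMk he), h, lintegral_prod _ hφ.aemeasurable,
    lintegral_map hφ.lintegral_prod_right' hZ]

/-! ### One-step prior -/

/-- If `X | Y` is inverted Wishart and `X'⁻¹ = k 𝒰(X⁻¹)' B 𝒰(X⁻¹)` with a singular beta shock `B`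
independent of `(Y, X)`, then `X' | Y` is inverted Wishart with one degree of freedom less and scale
`k⁻¹ S`. -/
theorem condInvWishart_evolution [IsProbabilityMeasure P] (hp : 1 ≤ p) {m k : ℝ} (hk : 0 < k)
    {X X' B : Ω → Mat p} {Y : Ω → E} (hX : Measurable X) (hX' : Measurable X')
    (hB : Measurable B) (hY : Measurable Y) {S : E → Mat p} (hS : Measurable S)
    (hΓ : multiGamma p ((m + 1) / 2) ≠ 0)
    (hν : ∀ S : Mat p, S.PosDef → IsProbabilityMeasure (invWishart (m + p + 1) S))
    (hpost : CondInvWishart P X Y (m + p + 2) S)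
    (hev : ∀ᵐ ω ∂P, (X' ω)⁻¹
      = k • ((choleskyUpper (X ω)⁻¹)ᵀ * B ω * choleskyUpper (X ω)⁻¹))
    (hlaw : HasLaw B (singularBeta p m) P) (hind : IndepFun B (fun ω => (Y ω, X ω)) P) :
    CondInvWishart P X' Y (m + p + 1) fun z => k⁻¹ • S z := by
  have hsm : Measurable fun X : Mat p => k⁻¹ • X := Continuous.measurable (by fun_prop)
  have hksm : Measurable fun X : Mat p => k • X := Continuous.measurable (by fun_prop)
  have hBpd : ∀ᵐ ω ∂P, (B ω).PosDef := by
    refine ae_of_ae_map hB.aemeasurable ?_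
    rw [hlaw.map_eq]
    exact ae_posDef_singularBeta p m
  have hX'eq : ∀ᵐ ω ∂P, X' ω
      = (k • ((choleskyUpper (X ω)⁻¹)ᵀ * B ω * choleskyUpper (X ω)⁻¹))⁻¹ := by
    filter_upwards [hev, hBpd, hpost.ae_posDef hX hY] with ω h1 h2 h3
    have hU := isCholesky_choleskyUpper h3.inv
    have hM := ((posDef_cong_iff' (hU.det_ne_zero h3.inv)).2 h2).smul hk
    rw [← h1] at hM ⊢
    have hd : (X' ω).det ≠ 0 := fun h0 => by
      have := hM.det_pos
      rw [Matrix.det_nonsing_inv, Ring.inverse_eq_inv', h0, _root_.inv_zero] at this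
      exact this.false
    rw [Matrix.nonsing_inv_nonsing_inv _ (isUnit_iff_ne_zero.2 hd)]
  refine condInvWishart_of_lintegral hX' hY hν (hsm.comp hS) ?_ fun φ hφ => ?_
  · filter_upwards [hpost] with z hz
    exact hz.1.smul (inv_pos.2 hk)
  · have : IsProbabilityMeasure (singularBeta p m) := hlaw.isProbabilityMeasure_iff.1 inferInstance
    have hψ : Measurable fun q : (E × Mat p) × Mat p =>
        φ (q.1.1, (k • ((choleskyUpper q.1.2⁻¹)ᵀ * q.2 * choleskyUpper q.1.2⁻¹))⁻¹) := by
      have h1 : Measurable fun q : (E × Mat p) × Mat p => q.1.2 := by fun_prop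
      have h2 := measurable_cholesky_conj (measurable_inv.comp h1) measurable_snd
      have h3 := measurable_inv.comp (hksm.comp h2)
      exact hφ.comp ((measurable_fst.comp measurable_fst).prodMk h3)
    calc ∫⁻ ω, φ (Y ω, X' ω) ∂P
        = ∫⁻ ω, φ (Y ω, (k • ((choleskyUpper (X ω)⁻¹)ᵀ * B ω * choleskyUpper (X ω)⁻¹))⁻¹) ∂P := by
          refine lintegral_congr_ae ?_
          filter_upwards [hX'eq] with ω hω
          rw [← hω]
      _ = ∫⁻ ω, ∫⁻ b, φ (Y ω, (k • ((choleskyUpper (X ω)⁻¹)ᵀ * b * choleskyUpper (X ω)⁻¹))⁻¹)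
            ∂singularBeta p m ∂P :=
          lintegral_comp_of_indepFun (hY.prodMk hX) hB hlaw hind hψ
      _ = ∫⁻ z, ∫⁻ x, ∫⁻ b, φ (z, (k • ((choleskyUpper x⁻¹)ᵀ * b * choleskyUpper x⁻¹))⁻¹)
            ∂singularBeta p m ∂invWishart (m + p + 2) (S z) ∂(P.map Y) :=
          hpost.lintegral_eq hX hY hψ.lintegral_prod_right'
      _ = ∫⁻ z, ∫⁻ x, φ (z, x) ∂invWishart (m + p + 1) (k⁻¹ • S z) ∂(P.map Y) := by
          refine lintegral_congr_ae ?_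
          filter_upwards [hpost] with z hz
          exact lintegral_evolution hp hk hΓ hz.1 (f := fun x => φ (z, x))
            (hφ.comp measurable_prodMk_left)

end Conditional

/-! ### Posterior -/

/-- The density of `R e` for a standard Gaussian vector `e`, where `R R' = X`. -/
theorem lintegral_stdGaussian_mulVec {X R : Mat p} (hX : X.PosDef) (hR : R * Rᵀ = X)
    {f : Vec p → ℝ≥0∞} (hf : Measurable f) :
    ∫⁻ e, f (WithLp.toLp 2 (R *ᵥ e.ofLp)) ∂stdGaussian (Vec p)
      = ∫⁻ y : Vec p, ENNReal.ofReal ((2 * Real.pi) ^ (-(p : ℝ) / 2) * X.det ^ (-(1 / 2 : ℝ)) *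
        Real.exp (-(vecMulVec y.ofLp y.ofLp * X⁻¹).trace / 2)) * f y := by
  have hXd := hX.det_pos
  have hRR : R.det * R.det = X.det := by rw [← hR, det_mul, det_transpose]
  have hR0 : R.det ≠ 0 := fun h => hXd.ne (by rw [← hRR, h, zero_mul])
  have hRu : IsUnit R.det := isUnit_iff_ne_zero.2 hR0
  have hRtu : IsUnit (Rᵀ).det := by rwa [det_transpose]
  have habs : |R.det| = X.det ^ (1 / 2 : ℝ) := by
    rw [← hRR, ← Real.sqrt_eq_rpow, Real.sqrt_mul_self_eq_abs]
  have htr : Measurable fun y : Vec p => (vecMulVec y.ofLp y.ofLp * X⁻¹).trace := by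
    have h1 : Measurable fun Y : Mat p => (Y * X⁻¹).trace := Continuous.measurable (by fun_prop)
    exact h1.comp measurable_vecMulVec
  rw [stdGaussian_eq_withDensity, lintegral_withDensity_eq_lintegral_mul _ (by fun_prop) (by fun_prop)]
  refine Eq.trans ?_ (lintegral_mulVec R hR0 (by fun_prop))
  rw [← lintegral_const_mul' _ _ ENNReal.ofReal_ne_top]
  refine lintegral_congr fun e => ?_
  rw [Pi.mul_apply, ← mul_assoc, ← ENNReal.ofReal_mul (abs_nonneg _)]
  congr 2
  have hq : (vecMulVec (R *ᵥ e.ofLp) (R *ᵥ e.ofLp) * X⁻¹).trace = ‖e‖ ^ 2 := by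
    have h1 : Rᵀ * (X⁻¹ * R) = 1 := by
      rw [← hR, Matrix.mul_inv_rev, Matrix.mul_assoc, Matrix.nonsing_inv_mul _ hRu, Matrix.mul_one,
        Matrix.mul_nonsing_inv _ hRtu]
    rw [Matrix.trace_mul_comm, trace_mul_vecMulVec, Matrix.mulVec_mulVec, ← Matrix.vecMul_transpose,
      ← Matrix.dotProduct_mulVec, Matrix.mulVec_mulVec, h1, Matrix.one_mulVec,
      EuclideanSpace.real_norm_sq_eq]
    simp [dotProduct, pow_two]
  rw [hq, habs, Real.rpow_neg hXd.le]
  have : X.det ^ (1 / 2 : ℝ) ≠ 0 := by positivity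
  field_simp

theorem iwConst_pos {ν : ℝ} (hΓ : multiGamma p ((ν - p - 1) / 2) ≠ 0) {S : Mat p}
    (hS : S.PosDef) : 0 < iwConst ν S := by
  have h1 : 0 < multiGamma p ((ν - p - 1) / 2) := (multiGamma_nonneg p _).lt_of_ne' hΓ
  have h2 := hS.det_pos
  unfold iwConst
  positivity

/-- Bayes' formula for a Gaussian observation `y = R(X) e` of covariance `X ∼ IW_p(ν, T)`: given
`y`, the law of `X` is `IW_p(ν + 1, T + y y')`. -/
theorem lintegral_invWishart_gaussian {ν : ℝ} (hΓ : multiGamma p ((ν + 1 - p - 1) / 2) ≠ 0)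
    {R : Mat p → Mat p} (hR : IsMatrixSqrt R) {T : Mat p} (hT : T.PosDef)
    {φ : Vec p × Mat p → ℝ≥0∞} (hφ : Measurable φ) :
    ∫⁻ X, ∫⁻ e, φ (WithLp.toLp 2 (R X *ᵥ e.ofLp), X) ∂stdGaussian (Vec p) ∂invWishart ν T
      = ∫⁻ y : Vec p, ENNReal.ofReal ((2 * Real.pi) ^ (-(p : ℝ) / 2) *
          (iwConst ν T / iwConst (ν + 1) (T + vecMulVec y.ofLp y.ofLp))) *
        ∫⁻ X, φ (y, X) ∂invWishart (ν + 1) (T + vecMulVec y.ofLp y.ofLp) := by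
  rw [lintegral_invWishart]
  have htr : Measurable fun q : Mat p × Vec p => (vecMulVec q.2.ofLp q.2.ofLp * q.1⁻¹).trace := by
    simp only [Matrix.trace, Matrix.diag_apply, Matrix.mul_apply, vecMulVec_apply]
    refine Finset.measurable_sum _ fun i _ => Finset.measurable_sum _ fun j _ => Measurable.mul ?_ ?_
    · fun_prop
    · exact ((measurable_entry j i).comp measurable_inv).comp measurable_fst
  have hdet : Measurable fun q : Mat p × Vec p => q.1.det := measurable_det.comp measurable_fst
  have hdens : Measurable fun q : Mat p × Vec p => invWishartDensity ν T q.1 :=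
    measurable_invWishartDensity ν measurable_const measurable_fst
  have hφ' : Measurable fun q : Mat p × Vec p => φ (q.2, q.1) := hφ.comp measurable_swap
  have hG : Measurable fun q : Mat p × Vec p => ENNReal.ofReal (invWishartDensity ν T q.1) *
      (ENNReal.ofReal ((2 * Real.pi) ^ (-(p : ℝ) / 2) * q.1.det ^ (-(1 / 2 : ℝ)) *
        Real.exp (-(vecMulVec q.2.ofLp q.2.ofLp * q.1⁻¹).trace / 2)) * φ (q.2, q.1)) := by
    fun_prop
  have step1 : ∫⁻ X in {X : Mat p | X.PosDef}, ENNReal.ofReal (invWishartDensity ν T X) *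
        ∫⁻ e, φ (WithLp.toLp 2 (R X *ᵥ e.ofLp), X) ∂stdGaussian (Vec p) ∂symVolume p
      = ∫⁻ X in {X : Mat p | X.PosDef}, (∫⁻ y : Vec p, ENNReal.ofReal (invWishartDensity ν T X) *
      (ENNReal.ofReal ((2 * Real.pi) ^ (-(p : ℝ) / 2) * X.det ^ (-(1 / 2 : ℝ)) *
        Real.exp (-(vecMulVec y.ofLp y.ofLp * X⁻¹).trace / 2)) * φ (y, X))) ∂symVolume p := by
    refine setLIntegral_congr_fun measurableSet_posDef fun X (hX : X.PosDef) => ?_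
    simp only
    rw [lintegral_stdGaussian_mulVec hX (hR.2 X hX) (f := fun y => φ (y, X))
      (hφ.comp measurable_prodMk_right), lintegral_const_mul' _ _ ENNReal.ofReal_ne_top]
  rw [step1, lintegral_lintegral_swap hG.aemeasurable]
  refine lintegral_congr fun y => ?_
  rw [lintegral_invWishart, ← lintegral_const_mul' _ _ ENNReal.ofReal_ne_top]
  refine setLIntegral_congr_fun measurableSet_posDef fun X (hX : X.PosDef) => ?_
  have hXd := hX.det_pos
  have hT' := posDef_add_vecMulVec hT y.ofLp
  have hc := iwConst_nonneg ν hT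
  have hc' := iwConst_pos hΓ hT'
  simp only
  rw [invWishartDensity_eq _ _ hX, invWishartDensity_eq _ _ hX,
    ← mul_assoc (ENNReal.ofReal _) (ENNReal.ofReal _), ← mul_assoc (ENNReal.ofReal _)
      (ENNReal.ofReal _), ← ENNReal.ofReal_mul (by positivity), ← ENNReal.ofReal_mul (by positivity)]
  congr 2
  have e1 : Real.exp (-((T + vecMulVec y.ofLp y.ofLp) * X⁻¹).trace / 2)
      = Real.exp (-(T * X⁻¹).trace / 2) *
        Real.exp (-(vecMulVec y.ofLp y.ofLp * X⁻¹).trace / 2) := by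
    rw [← Real.exp_add, Matrix.add_mul, Matrix.trace_add]
    congr 1
    ring
  have e2 : X.det ^ (-((ν + 1) / 2)) = X.det ^ (-(ν / 2)) * X.det ^ (-(1 / 2 : ℝ)) := by
    rw [← Real.rpow_add hXd]
    congr 1
    ring
  rw [e1, e2]
  field_simp

/-- Posterior of a covariance matrix after one more Gaussian observation `y = R(X) e`. The
conditioning variable is enlarged from `Y` to `s (Y, y)`. -/
theorem condInvWishart_observation {Ω E F : Type*} [MeasurableSpace Ω] [MeasurableSpace E]
    [MeasurableSpace F] {P : Measure Ω} [IsProbabilityMeasure P] {ν : ℝ}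
    (hν : ∀ S : Mat p, S.PosDef → IsProbabilityMeasure (invWishart (ν + 1) S))
    {R : Mat p → Mat p} (hR : IsMatrixSqrt R) {X : Ω → Mat p} {Y : Ω → E} {y e : Ω → Vec p}
    {Y' : Ω → F} (hX : Measurable X) (hY : Measurable Y) (he : Measurable e)
    (hY' : Measurable Y') {s : E × Vec p → F} (hs : Measurable s)
    (hYs : ∀ ω, Y' ω = s (Y ω, y ω)) {T : E → Mat p}
    {T' : F → Mat p} (hT' : Measurable T')
    (hTT' : ∀ z v, T' (s (z, v)) = T z + vecMulVec v.ofLp v.ofLp)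
    (hprior : CondInvWishart P X Y ν T)
    (hobs : ∀ᵐ ω ∂P, y ω = WithLp.toLp 2 (R (X ω) *ᵥ (e ω).ofLp))
    (hlaw : HasLaw e (stdGaussian (Vec p)) P) (hind : IndepFun e (fun ω => (Y ω, X ω)) P) :
    CondInvWishart P X Y' (ν + 1) T' := by
  have hΓ : multiGamma p ((ν + 1 - p - 1) / 2) ≠ 0 :=
    multiGamma_ne_zero_of_isProbabilityMeasure (hν 1 Matrix.PosDef.one)
  have hmulVec : Measurable fun q : (E × Mat p) × Vec p =>
      (WithLp.toLp 2 (R q.1.2 *ᵥ q.2.ofLp) : Vec p) := by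
    refine (WithLp.measurable_toLp 2 _).comp (measurable_pi_lambda _ fun i => ?_)
    simp only [Matrix.mulVec, dotProduct]
    refine Finset.measurable_sum _ fun j _ => Measurable.mul ?_ (by fun_prop)
    exact ((measurable_entry i j).comp hR.1).comp (measurable_snd.comp measurable_fst)
  -- the joint law of `(Y', X)`, with the density of `y` given `Y`
  have key : ∀ φ : F × Mat p → ℝ≥0∞, Measurable φ → ∫⁻ ω, φ (Y' ω, X ω) ∂P
      = ∫⁻ z, (∫⁻ v : Vec p, ENNReal.ofReal ((2 * Real.pi) ^ (-(p : ℝ) / 2) *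
          (iwConst ν (T z) / iwConst (ν + 1) (T z + vecMulVec v.ofLp v.ofLp))) *
        ∫⁻ x, φ (s (z, v), x) ∂invWishart (ν + 1) (T z + vecMulVec v.ofLp v.ofLp)) ∂(P.map Y) := by
    intro φ hφ
    have hψ : Measurable fun q : (E × Mat p) × Vec p =>
        φ (s (q.1.1, WithLp.toLp 2 (R q.1.2 *ᵥ q.2.ofLp)), q.1.2) :=
      hφ.comp ((hs.comp ((measurable_fst.comp measurable_fst).prodMk hmulVec)).prodMk
        (measurable_snd.comp measurable_fst))
    calc ∫⁻ ω, φ (Y' ω, X ω) ∂P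
        = ∫⁻ ω, φ (s (Y ω, WithLp.toLp 2 (R (X ω) *ᵥ (e ω).ofLp)), X ω) ∂P := by
          refine lintegral_congr_ae ?_
          filter_upwards [hobs] with ω hω
          rw [hYs, hω]
      _ = ∫⁻ ω, ∫⁻ u, φ (s (Y ω, WithLp.toLp 2 (R (X ω) *ᵥ u.ofLp)), X ω)
            ∂stdGaussian (Vec p) ∂P :=
          lintegral_comp_of_indepFun (hY.prodMk hX) he hlaw hind hψ
      _ = ∫⁻ z, ∫⁻ x, ∫⁻ u, φ (s (z, WithLp.toLp 2 (R x *ᵥ u.ofLp)), x)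
            ∂stdGaussian (Vec p) ∂invWishart ν (T z) ∂(P.map Y) :=
          hprior.lintegral_eq hX hY hψ.lintegral_prod_right'
      _ = _ := by
          refine lintegral_congr_ae ?_
          filter_upwards [hprior] with z hz
          refine lintegral_invWishart_gaussian hΓ hR hz.1 (φ := fun q => φ (s (z, q.1), q.2)) ?_
          exact hφ.comp ((hs.comp (measurable_const.prodMk measurable_fst)).prodMk measurable_snd)
  refine condInvWishart_of_lintegral hX hY' hν hT' ?_ fun φ hφ => ?_
  · refine (ae_map_iff hY'.aemeasurable (hT' measurableSet_posDef)).2 ?_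
    filter_upwards [ae_of_ae_map hY.aemeasurable hprior] with ω hω
    rw [hYs, hTT']
    exact posDef_add_vecMulVec hω.1 _
  · -- applied to a function of `Y'` alone, `key` gives the law of `Y'`, the inverted Wishart laws having
    -- mass one
    have hψ := measurable_lintegral_invWishart (ν + 1) hT' hφ
    rw [lintegral_map hψ hY', key φ hφ]
    refine Eq.trans (lintegral_congr_ae ?_) (key _ (hψ.comp measurable_fst)).symm
    filter_upwards [hprior] with z hz
    refine lintegral_congr fun v => ?_
    have := hν _ (posDef_add_vecMulVec hz.1 v.ofLp)
    simp only [Function.comp_apply, hTT', lintegral_const, measure_univ, mul_one]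

/-! ### The volatility model -/

/-- The evolution carries a probability measure to `IW_p(m + p + 1, S)`, so that this law is
normalised. -/
theorem isProbabilityMeasure_invWishart_add_one (hp : 1 ≤ p) {m : ℝ}
    [IsProbabilityMeasure (singularBeta p m)]
    (hν : ∀ S : Mat p, S.PosDef → IsProbabilityMeasure (invWishart (m + p + 2) S))
    (hΓ : multiGamma p ((m + 1) / 2) ≠ 0) {S : Mat p} (hS : S.PosDef) :
    IsProbabilityMeasure (invWishart (m + p + 1) S) := by
  have := hν S hS
  have h := lintegral_invWishart_singularBeta hp hΓ hS (f := fun _ => 1) measurable_const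
  simp only [lintegral_const, measure_univ, one_mul, mul_one] at h
  exact ⟨h.symm⟩

theorem smul_inv_eq_smul_inv_iff (hp : 1 ≤ p) {S : Mat p} (hS : S.PosDef) (a b : ℝ) :
    a • S⁻¹ = b • S⁻¹ ↔ a = b := by
  have : Nonempty (Fin p) := ⟨⟨0, hp⟩⟩
  have hne : S⁻¹ ≠ 0 := fun h => by
    have := hS.inv.det_pos
    rw [h, Matrix.det_zero] at this
    exact this.false
  rw [← sub_eq_zero, ← sub_smul, smul_eq_zero, or_iff_left hne, sub_eq_zero]

theorem measurable_obs {Ω : Type*} [MeasurableSpace Ω] {y : ℕ → Ω → Vec p}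
    (hy : ∀ t, Measurable (y t)) (t : ℕ) : Measurable (obs y t) :=
  measurable_pi_lambda _ fun i => hy (i + 1)

theorem obs_succ {Ω : Type*} (y : ℕ → Ω → Vec p) (t : ℕ) (ω : Ω) :
    obs y (t + 1) ω = Fin.snoc (α := fun _ => Vec p) (obs y t ω) (y (t + 1) ω) := by
  funext i
  refine Fin.lastCases ?_ (fun i => ?_) i <;> simp [obs]

theorem measurable_snoc (t : ℕ) : Measurable fun q : (Fin t → Vec p) × Vec p =>
    (Fin.snoc (α := fun _ => Vec p) q.1 q.2 : Fin (t + 1) → Vec p) := by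
  refine measurable_pi_lambda _ fun i => ?_
  refine Fin.lastCases ?_ (fun i => ?_) i
  · simpa using measurable_snd
  · simp only [Fin.snoc_castSucc]
    fun_prop

end StochVol

theorem mainTheorem2 {Ω : Type*} [MeasurableSpace Ω] (P : Measure Ω) [IsProbabilityMeasure P]
    (p N : ℕ) (hp : 1 ≤ p) (δ n k : ℝ) (hδ0 : 0 < δ) (hδ1 : δ < 1) (hn : n = 1 / (1 - δ))
    (hk : 0 < k) (R : StochVol.Mat p → StochVol.Mat p) (hR : StochVol.IsMatrixSqrt R)
    (y : ℕ → Ω → StochVol.Vec p) (Sig B : ℕ → Ω → StochVol.Mat p) (ε : ℕ → Ω → StochVol.Vec p)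
    (hmodel : StochVol.VolatilityModel P N δ k R y Sig B ε)
    (t : ℕ) (ht : t < N)
    (S : (Fin t → StochVol.Vec p) → StochVol.Mat p) (hS : Measurable S)
    (hpost : StochVol.CondInvWishart P (Sig t) (StochVol.obs y t) (n + 2 * p) S) :
    StochVol.CondInvWishart P (Sig (t + 1)) (StochVol.obs y t) (δ * n + 2 * p)
        (fun z => k⁻¹ • S z) ∧
    (∀ᵐ z ∂(P.map (StochVol.obs y t)),
      StochVol.InvIntegrable (condDistrib (Sig t) (StochVol.obs y t) P z) ∧
      StochVol.InvIntegrable (condDistrib (Sig (t + 1)) (StochVol.obs y t) P z)) ∧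
    ((∀ᵐ z ∂(P.map (StochVol.obs y t)),
      StochVol.meanInv (condDistrib (Sig (t + 1)) (StochVol.obs y t) P z) =
        StochVol.meanInv (condDistrib (Sig t) (StochVol.obs y t) P z)) ↔
      k = (δ * (1 - p) + p) / (δ * (2 - p) + p - 1)) ∧
    StochVol.CondInvWishart P (Sig (t + 1)) (StochVol.obs y (t + 1)) (n + 2 * p)
      (fun z => k⁻¹ • S (fun i => z i.castSucc) +
        Matrix.vecMulVec (z (Fin.last t)).ofLp (z (Fin.last t)).ofLp) := by
  have hδ : 0 < 1 - δ := sub_pos.2 hδ1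
  obtain ⟨m, hm⟩ : ∃ m : ℝ, m = δ * (1 - δ)⁻¹ + p - 1 := ⟨_, rfl⟩
  -- `δ n = n - 1`, so that `n + 2 p` and `δ n + 2 p` are consecutive
  have hν2 : n + 2 * p = m + p + 2 := by
    rw [hn, hm]; field_simp; ring
  have hν1 : δ * n + 2 * p = m + p + 1 := by
    rw [hn, hm]; field_simp; ring
  have hp1 : (1 : ℝ) ≤ p := by exact_mod_cast hp
  have hobs := StochVol.measurable_obs hmodel.measurable_y
  have hXm := hmodel.measurable_Sig
  have hlawB := hmodel.law_B t ht
  rw [← hm] at hlawB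
  rw [hν2] at hpost
  have : IsProbabilityMeasure (StochVol.singularBeta p m) :=
    hlawB.isProbabilityMeasure_iff.1 inferInstance
  have : IsProbabilityMeasure (P.map (StochVol.obs y t)) :=
    Measure.isProbabilityMeasure_map (hobs t).aemeasurable
  have hprob2 : ∀ T : StochVol.Mat p, T.PosDef →
      IsProbabilityMeasure (StochVol.invWishart (m + p + 2) T) := by
    -- some value `S z` is positive definite with a normalised law
    obtain ⟨z, hz, hcond⟩ := hpost.exists
    have h : IsProbabilityMeasure (StochVol.invWishart (m + p + 2) (S z)) := by
      rw [← hcond]; infer_instance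
    exact fun T hT => StochVol.isProbabilityMeasure_invWishart hz h hT
  have hΓ : StochVol.multiGamma p ((m + 1) / 2) ≠ 0 := by
    have h := StochVol.multiGamma_ne_zero_of_isProbabilityMeasure (hprob2 1 Matrix.PosDef.one)
    have e : (m + p + 2 - p - 1) / 2 = (m + 1) / 2 := by ring
    rwa [e] at h
  have hprob1 := fun (T : StochVol.Mat p) (hT : T.PosDef) =>
    StochVol.isProbabilityMeasure_invWishart_add_one hp hprob2 hΓ hT
  have hprior : StochVol.CondInvWishart P (Sig (t + 1)) (StochVol.obs y t) (m + p + 1)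
      (fun z => k⁻¹ • S z) :=
    StochVol.condInvWishart_evolution hp hk (hXm t) (hXm (t + 1)) (hmodel.measurable_B (t + 1))
      (hobs t) hS hΓ hprob1 hpost (hmodel.evolution t ht) hlawB (hmodel.indep_B t ht)
  -- the two conditional means are `m k (S z)⁻¹` and `(m + 1) (S z)⁻¹`
  have hmean : ∀ᵐ z ∂(P.map (StochVol.obs y t)),
      (StochVol.meanInv (condDistrib (Sig (t + 1)) (StochVol.obs y t) P z) =
        StochVol.meanInv (condDistrib (Sig t) (StochVol.obs y t) P z)) ↔ m * k = m + 1 := by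
    filter_upwards [hpost, hprior] with z h2 h1
    rw [h2.2, h1.2, (StochVol.invIntegrable_and_meanInv hprob2 h2.1).2,
      (StochVol.invIntegrable_and_meanInv hprob1 h1.1).2,
      StochVol.inv_smul_of_posDef (inv_pos.2 hk) h2.1, inv_inv, smul_smul,
      StochVol.smul_inv_eq_smul_inv_iff hp h2.1]
    have e1 : (m + p + 1 - p - 1) * k = m * k := by ring
    have e2 : m + p + 2 - p - 1 = m + 1 := by ring
    rw [e1, e2]
  have hkm : m * k = m + 1 ↔ k = (δ * (1 - p) + p) / (δ * (2 - p) + p - 1) := by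
    have hden : 0 < δ * (2 - p) + p - 1 := by nlinarith
    have e1 : m = (δ * (2 - p) + p - 1) / (1 - δ) := by
      rw [hm]; field_simp; ring
    have e2 : m + 1 = (δ * (1 - p) + p) / (1 - δ) := by
      rw [hm]; field_simp; ring
    rw [e2, e1, eq_div_iff hden.ne', div_mul_eq_mul_div, div_left_inj' hδ.ne', mul_comm]
  refine ⟨hν1 ▸ hprior, ?_, ?_, ?_⟩
  · filter_upwards [hpost, hprior] with z h2 h1
    rw [h2.2, h1.2]
    exact ⟨(StochVol.invIntegrable_and_meanInv hprob2 h2.1).1,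
      (StochVol.invIntegrable_and_meanInv hprob1 h1.1).1⟩
  · -- the equation for `k` does not involve `z`, so that one value of `z` decides
    rw [← hkm]
    constructor
    · intro h
      obtain ⟨z, h1, h2⟩ := (h.and hmean).exists
      exact h2.1 h1
    · intro h
      filter_upwards [hmean] with z hz
      exact hz.2 h
  · have hν12 : n + 2 * p = m + p + 1 + 1 := by rw [hν2]; ring
    have hprob2' : ∀ T : StochVol.Mat p, T.PosDef →
        IsProbabilityMeasure (StochVol.invWishart (m + p + 1 + 1) T) := by
      rw [← hν12, hν2]; exact hprob2
    rw [hν12]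
    refine StochVol.condInvWishart_observation hprob2' hR (hXm (t + 1)) (hobs t)
      (hmodel.measurable_ε (t + 1)) (hobs (t + 1)) (StochVol.measurable_snoc t)
      (StochVol.obs_succ y t) ?_ (fun z v => ?_) hprior (hmodel.observation t ht)
      (hmodel.law_ε t ht) (hmodel.indep_ε t ht)
    · have h1 : Measurable fun z : Fin (t + 1) → StochVol.Vec p => fun i : Fin t => z i.castSucc := by
        fun_prop
      have h2 : Measurable fun z : Fin (t + 1) → StochVol.Vec p =>
          Matrix.vecMulVec (z (Fin.last t)).ofLp (z (Fin.last t)).ofLp :=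
        StochVol.measurable_vecMulVec.comp (measurable_pi_apply (Fin.last t))
      refine StochVol.measurable_of_entries fun i j => ?_
      simp only [Matrix.add_apply, Matrix.smul_apply, smul_eq_mul]
      exact (((StochVol.measurable_entry i j).comp (hS.comp h1)).const_mul _).add
        ((StochVol.measurable_entry i j).comp h2)
    · simp
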